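/- Let $m\ge 2$, $d\ge 0$, let $f_1,\dots,f_m:\mathbb R^d\to\mathbb R$ be differentiable, $f=\frac1m\sum_{i=1}^m f_i$, and $x^0\in\mathbb R^d$. Assume: (1) $\inf f>-\infty$; put $\Delta=f(x^0)-\inf f$. (2) Node $i$ has a distribution $\mathcal D_i$ and a (jointly measurable) stochastic gradient $g_i(x;\xi)$ with $\mathbb E_{\xi\sim\mathcal D_i}[g_i(x;\xi)]=\nabla f_i(x)$ and $\mathbb E_{\xi\sim\mathcal D_i}\|g_i(x;\xi)-\nabla f_i(x)\|^2\le\sigma_i^2$ for all $x$, where $\sigma_i>0$. (3) For some $L>0$, $\|\nabla f(x)-\nabla f(y)\|^2\le L^2\|x-y\|^2$ and $\|\nabla f_i(x)-\nabla f_i(y)\|^2\le m^2L^2\|x-y\|^2$ for all $x,y$ and $i$. (4) $W\in\mathbb R^{m\times m}$ is symmetric and entrywise nonnegative, $W_{ij}\neq0$ if and only if $i=j$ or $i,j$ are adjacent in the network, $0\preceq W\preceq I$, $W\mathbf 1=W^\top\mathbf 1=\mathbf 1$, and $\ker(I-W)=\operatorname{span}(\mathbf 1)$. Let $\lambda_2$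 be the second largest eigenvalue of $W$ and $\chi=1-\lambda_2$. For vectors $\phi_1,\dots,\phi_m$ let $\mathrm{FastMix}(\{\phi_i\},W,R)=\{z_i^R\}$, where $z_i^0=z_i^{-1}=\phi_i$ and $z_i^{r+1}=(1+\theta)\sum_jW_{ij}z_j^r-\theta z_i^{r-1}$ with $\theta=\frac{1-\sqrt{1-\lambda_2^2}}{1+\sqrt{1-\lambda_2^2}}$ (this takes $R$ communication rounds). The algorithm D-NSS starts with $x_i^0=x^0$ and $s_i^{-1}=y_i^{-1}=0$ and, for $t=0,1,\dots,T-1$, draws fresh independent samples $\xi_{i,1}^t,\dots,\xi_{i,B_i}^t\sim\mathcal D_i$ at every node $i$ and sets $$y_i^t=\frac1{B_i}\sum_{j=1}^{B_i}g_i(x_i^t;\xi_{i,j}^t),\quad s_i^t=\mathrm{FastMix}(\{s_i^{t-1}+y_i^t-y_i^{t-1}\},W,R_t)_i,\quad x_i^{t+1}=\mathrm{FastMix}(\{x_i^t-\eta s_i^t\},W,R_t)_i .$$ All samples are independent across nodes, iterations and draws. The output $x_{i,\mathrm{out}}$ is drawn uniformly from $\{x_i^0,\dots,x_i^T\}$,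 with a random index independent of the samples. Put $\bar\sigma_{\mathrm{AM}}=\frac1m\sum_i\sigma_i$ and $G_0=\big(\frac1m\sum_i\|\nabla f_i(x^0)\|^2\big)^{1/2}$. Then there are absolute constants $c,C>0$ such that, for all data as above and every $\epsilon>0$, D-NSS run with $$\eta=\frac1{2L},\quad B_i=\left\lceil\frac{16\,\sigma_i\sum_{j}\sigma_j}{m^2\epsilon^2}\right\rceil,\quad T=\left\lceil\frac{32\Delta L}{\epsilon^2}\right\rceil,\quad R_0=\left\lceil\frac c{\sqrt\chi}\log\Big(m\Big(1+\frac{G_0}{\epsilon}\Big)\Big)\right\rceil,\quad R_t=\left\lceil\frac c{\sqrt\chi}\log m\right\rceil\ (t\ge1)$$ satisfies $\mathbb E\|\nabla f(x_{i,\mathrm{out}})\|^2\le\epsilon^2$ for every node $i$. Moreover, if $\epsilon^2\le2\Delta L$ (otherwise $x^0$ itself already satisfies $\|\nabla f(x^0)\|^2\le\epsilon^2$), the total number of stochastic gradient evaluations over all nodes is at most $$C\left(\frac{\Delta L\,\bar\sigma_{\mathrm{AM}}^2}{\epsilon^4}+\frac{m\Delta L}{\epsilon^2}\right),$$ and the total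 number of communication rounds (both FastMix calls of every iteration counted) is at most $$C\,\frac{\Delta L}{\sqrt\chi\,\epsilon^2}\,\log\Big(m\Big(1+\frac{G_0}{\epsilon}\Big)\Big).$$ -/

import Mathlib

open MeasureTheory ProbabilityTheory

noncomputable section

/-! ### The decentralized problem -/

/-- The global objective `f(x) = (1/m) ∑ᵢ fᵢ(x)`. -/
def avgObjective {m d : ℕ} (f : Fin m → EuclideanSpace ℝ (Fin d) → ℝ)
    (x : EuclideanSpace ℝ (Fin d)) : ℝ :=
  (m : ℝ)⁻¹ * ∑ i, f i x

/-- `K`-smoothness: `h` is differentiable and `‖∇h(x) - ∇h(y)‖² ≤ K² ‖x - y‖²` for all `x, y`. -/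
structure SmoothWith {d : ℕ} (K : ℝ) (h : EuclideanSpace ℝ (Fin d) → ℝ) : Prop where
  differentiable : Differentiable ℝ h
  lipschitz : ∀ x y, ‖gradient h x - gradient h y‖ ^ 2 ≤ K ^ 2 * ‖x - y‖ ^ 2

/-- `g` is a stochastic gradient oracle for `h` when the random index is drawn from `D`: it is
jointly measurable, unbiased, and has variance at most `σ²` (in particular finite variance). -/
structure IsStochasticGradient {d : ℕ} {X : Type*} [MeasurableSpace X] (D : Measure X)
    (g : EuclideanSpace ℝ (Fin d) → X → EuclideanSpace ℝ (Fin d))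
    (h : EuclideanSpace ℝ (Fin d) → ℝ) (σ : ℝ) : Prop where
  measurable : Measurable (Function.uncurry g)
  memLp : ∀ x, MemLp (g x) 2 D
  unbiased : ∀ x, ∫ z, g x z ∂D = gradient h x
  variance_le : ∀ x, ∫ z, ‖g x z - gradient h x‖ ^ 2 ∂D ≤ σ ^ 2

/-- The communication matrix `W` of the network `G`: symmetric, entrywise nonnegative, supported
exactly on the diagonal and the edges, `0 ⪯ W ⪯ I`, `Wᵀ𝟏 = W𝟏 = 𝟏`, `ker (I - W) = span 𝟏`. -/
structure IsCommunicationMatrix {m : ℕ} (G : SimpleGraph (Fin m))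
    (W : Matrix (Fin m) (Fin m) ℝ) : Prop where
  symm : W.IsSymm
  nonneg : ∀ i j, 0 ≤ W i j
  support : ∀ i j, W i j ≠ 0 ↔ (G.Adj i j ∨ i = j)
  posSemidef : W.PosSemidef
  le_one : (1 - W).PosSemidef
  mulVec_one : W.mulVec 1 = 1
  transpose_mulVec_one : W.transpose.mulVec 1 = 1
  ker_eq : LinearMap.ker (1 - W).mulVecLin = Submodule.span ℝ {(1 : Fin m → ℝ)}

/-- The second largest eigenvalue `λ₂(W)`, counted with multiplicity, of a symmetric matrix of size
at least two (`eigenvalues₀` lists the eigenvalues in decreasing order, starting at index `0`);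
the value `0` in all other cases is a convention that is never used. -/
def lambdaTwo {m : ℕ} (W : Matrix (Fin m) (Fin m) ℝ) : ℝ :=
  open Classical in
  if h : W.IsHermitian ∧ 1 < Fintype.card (Fin m) then h.1.eigenvalues₀ ⟨1, h.2⟩ else 0

/-- The spectral gap `χ = 1 - λ₂(W)`. -/
def spectralGap {m : ℕ} (W : Matrix (Fin m) (Fin m) ℝ) : ℝ := 1 - lambdaTwo W

/-! ### FastMix -/

/-- State of `FastMix` after `r` rounds: `cur = zʳ`, `prev = zʳ⁻¹`, and the number of
communication rounds that have been carried out. -/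
structure MixState (m d : ℕ) where
  cur : Fin m → EuclideanSpace ℝ (Fin d)
  prev : Fin m → EuclideanSpace ℝ (Fin d)
  rounds : ℕ

/-- The momentum parameter `(1 - √(1 - λ₂²)) / (1 + √(1 - λ₂²))` of `FastMix`. -/
def mixMomentum {m : ℕ} (W : Matrix (Fin m) (Fin m) ℝ) : ℝ :=
  (1 - √(1 - lambdaTwo W ^ 2)) / (1 + √(1 - lambdaTwo W ^ 2))

/-- One communication round: `zᵢʳ⁺¹ = (1 + η) ∑ⱼ Wᵢⱼ zⱼʳ - η zᵢʳ⁻¹`. -/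
def mixRound {m d : ℕ} (W : Matrix (Fin m) (Fin m) ℝ) (q : MixState m d) : MixState m d where
  cur := fun i => (1 + mixMomentum W) • (∑ j, W i j • q.cur j) - mixMomentum W • q.prev i
  prev := q.cur
  rounds := q.rounds + 1

/-- `FastMix({φᵢ}, W, R)`: `R` rounds started at `z⁰ = z⁻¹ = φ`. The output is the field `cur`. -/
def fastMix {m d : ℕ} (W : Matrix (Fin m) (Fin m) ℝ)
    (φ : Fin m → EuclideanSpace ℝ (Fin d)) : ℕ → MixState m d
  | 0 => ⟨φ, φ, 0⟩
  | r + 1 => mixRound W (fastMix W φ r)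

/-! ### D-NSS -/

/-- State of D-NSS at the beginning of iteration `t`: `x = xᵗ`, `s = sᵗ⁻¹`, `y = yᵗ⁻¹`, together
with the total number of stochastic gradient evaluations (over all nodes) and the number of
communication rounds performed so far. -/
structure DNSSState (m d : ℕ) where
  x : Fin m → EuclideanSpace ℝ (Fin d)
  s : Fin m → EuclideanSpace ℝ (Fin d)
  y : Fin m → EuclideanSpace ℝ (Fin d)
  gradEvals : ℕ
  commRounds : ℕ

/-- Iteration of D-NSS with step size `η`, batch sizes `B`, `R` rounds in each of the two calls of
`FastMix`, and the fresh samples `ξ i 0, ξ i 1, …` available at node `i` (of which the first `B i`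
are used). -/
def dnssStep {m d : ℕ} {Ξ : Fin m → Type*}
    (g : ∀ i, EuclideanSpace ℝ (Fin d) → Ξ i → EuclideanSpace ℝ (Fin d))
    (W : Matrix (Fin m) (Fin m) ℝ) (η : ℝ) (B : Fin m → ℕ) (R : ℕ)
    (ξ : ∀ i, ℕ → Ξ i) (q : DNSSState m d) : DNSSState m d :=
  let y : Fin m → EuclideanSpace ℝ (Fin d) :=
    fun i => (B i : ℝ)⁻¹ • ∑ j ∈ Finset.range (B i), g i (q.x i) (ξ i j)
  let sMix := fastMix W (fun i => q.s i + y i - q.y i) R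
  let xMix := fastMix W (fun i => q.x i - η • sMix.cur i) R
  { x := xMix.cur
    s := sMix.cur
    y := y
    gradEvals := q.gradEvals + ∑ i, B i
    commRounds := q.commRounds + (sMix.rounds + xMix.rounds) }

/-- D-NSS started at `x⁰` at every node, with `s⁻¹ = y⁻¹ = 0`; `R t` is the number of FastMix rounds
at iteration `t`, and `ξ t i j` the `j`-th sample available to node `i` at iteration `t`. -/
def dnss {m d : ℕ} {Ξ : Fin m → Type*}
    (g : ∀ i, EuclideanSpace ℝ (Fin d) → Ξ i → EuclideanSpace ℝ (Fin d))
    (W : Matrix (Fin m) (Fin m) ℝ) (η : ℝ) (B : Fin m → ℕ) (R : ℕ → ℕ)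
    (x₀ : EuclideanSpace ℝ (Fin d)) (ξ : ℕ → ∀ i, ℕ → Ξ i) : ℕ → DNSSState m d
  | 0 => ⟨fun _ => x₀, fun _ => 0, fun _ => 0, 0, 0⟩
  | t + 1 => dnssStep g W η B (R t) (ξ t) (dnss g W η B R x₀ ξ t)

/-! ### Parameters -/

/-- The initial optimality gap `Δ = f(x⁰) - inf f`. -/
def initialGap {d : ℕ} (h : EuclideanSpace ℝ (Fin d) → ℝ) (x₀ : EuclideanSpace ℝ (Fin d)) : ℝ :=
  h x₀ - ⨅ x, h x

/-- The arithmetic mean `σ_AM` of the standard deviations. -/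
def sigmaAM {m : ℕ} (σ : Fin m → ℝ) : ℝ := (m : ℝ)⁻¹ * ∑ i, σ i

/-- The size `G₀ = ((1/m) ∑ᵢ ‖∇fᵢ(x⁰)‖²)^(1/2)` of the local gradients at the initial point. -/
def initialGradSize {m d : ℕ} (f : Fin m → EuclideanSpace ℝ (Fin d) → ℝ)
    (x₀ : EuclideanSpace ℝ (Fin d)) : ℝ :=
  √((m : ℝ)⁻¹ * ∑ i, ‖gradient (f i) x₀‖ ^ 2)

/-- The batch sizes `Bᵢ = ⌈16 σᵢ ∑ⱼ σⱼ / (m² ε²)⌉`. -/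
def batchSize {m : ℕ} (σ : Fin m → ℝ) (ε : ℝ) (i : Fin m) : ℕ :=
  ⌈16 * σ i * (∑ j, σ j) / ((m : ℝ) ^ 2 * ε ^ 2)⌉₊

/-- The number of iterations `T = ⌈32 Δ L / ε²⌉`. -/
def numIter (Δ L ε : ℝ) : ℕ := ⌈32 * Δ * L / ε ^ 2⌉₊

/-- The FastMix rounds `R₀ = ⌈(c/√χ) log(m (1 + G₀/ε))⌉` and `Rₜ = ⌈(c/√χ) log m⌉` for `t ≥ 1`. -/
def mixRounds (c : ℝ) (m : ℕ) (χ G₀ ε : ℝ) (t : ℕ) : ℕ :=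
  if t = 0 then ⌈c / √χ * Real.log (m * (1 + G₀ / ε))⌉₊ else ⌈c / √χ * Real.log m⌉₊

end

/-! The average of the iterates performs mini-batch gradient descent on `avgObjective f`, perturbed
by a bias and by noise. `FastMix` preserves averages, and gradient tracking keeps the average of the
`s` equal to the average of the `y`, so the averaged step is `η` times the mean local gradient plus
the mean noise. With `η = 1/(2L)` the descent lemma, telescoped, gives `∑ N t ≤ 4LΔ + ∑ (m p t +
ε²/32)`, where `N t = E‖∇f(x̄ᵗ)‖²` and `p t = L² E devSq xᵗ` (`sum_integral_sq_norm_gradient_le`).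
The noise contributes only its variance: each sample error is centred given all other samples, so
distinct errors are orthogonal, and the batch sizes make the variance of the mean noise at most
`ε²/16`.

It remains to control the consensus error. In an eigendirection of `W` with eigenvalue at most `λ₂`,
`FastMix` is a two-term recurrence whose solution is `q ^ r`, with `q = √θ`, times a combination of
Chebyshev polynomials that grows at most linearly in `r`. Since `1 - q ≥ √χ`, `R` rounds shrink
`devSq` by `9 exp(-R√χ)` (`devSq_fastMix_le`). With `c = 20` this factor is at most `β = 9/m²⁰`.

The errors of the iterates and of the tracked gradients then obey a coupled recursion driven by `N
t` and `ε²`, with gain `κ = 20βm⁴` (`consensus_step_le`). The polynomial factor comes from the local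
smoothness constant `mL`, and `β` beats it. As `100 m κ ≤ 1`, the loop between gradients and
consensus error closes (`sum_stationarity_le`). The longer first mixing serves only to remove the
heterogeneity `G₀` of the initial gradients. Finally `‖∇f(xᵢ)‖² ≤ 2‖∇f(x̄)‖² + 2L² devSq x` passes
from the average to each node, and the uniform index turns the sum over time into the expectation at
the output. The complexity bounds are counting. -/

/-! ### The damped Chebyshev recurrence behind `FastMix` -/

/-- Differences `U_r(x) - U_{r-1}(x)` of consecutive Chebyshev polynomials of the second kind. -/
noncomputable def chebDiff (x : ℝ) : ℕ → ℝ
  | 0 => 1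
  | 1 => 2 * x - 1
  | r + 2 => 2 * x * chebDiff x (r + 1) - chebDiff x r

/-- The recurrence `v'' = 2xv' - v` conserves the quadratic form `v'² + v² - 2xv'v`; this is the
source of a bound uniform in `r`. -/
theorem chebDiff_invariant (x : ℝ) (r : ℕ) :
    chebDiff x (r + 1) ^ 2 + chebDiff x r ^ 2 - 2 * x * chebDiff x (r + 1) * chebDiff x r
      = 2 - 2 * x := by
  induction r with
  | zero => simp only [chebDiff]; ring
  | succ r ih =>
    rw [← ih]; simp only [chebDiff]; ring

theorem chebDiff_one (r : ℕ) : chebDiff 1 r = 1 ∧ chebDiff 1 (r + 1) = 1 := by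
  induction r with
  | zero => simp only [chebDiff]; norm_num
  | succ r ih => refine ⟨ih.2, ?_⟩; simp only [chebDiff]; rw [ih.1, ih.2]; norm_num

/-- Completing the square in the invariant leaves `(1 - x²) v² ≤ 2(1 - x)`. Cancelling `1 - x` needs
`x < 1`, hence the case split, and `1 + x ≥ 1` needs `0 ≤ x`, which `W ⪰ 0` will provide. -/
theorem sq_chebDiff_le {x : ℝ} (h0 : 0 ≤ x) (h1 : x ≤ 1) (r : ℕ) : chebDiff x r ^ 2 ≤ 2 := by
  rcases h1.eq_or_lt with rfl | h1
  · rw [(chebDiff_one r).1]; norm_num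
  · have h := chebDiff_invariant x r
    have h2 : (1 - x) * ((1 + x) * chebDiff x r ^ 2) ≤ (1 - x) * 2 := by
      nlinarith [sq_nonneg (chebDiff x (r + 1) - x * chebDiff x r)]
    have h3 := le_of_mul_le_mul_left h2 (by linarith)
    nlinarith [sq_nonneg (chebDiff x r), mul_nonneg h0 (sq_nonneg (chebDiff x r))]

theorem abs_chebDiff_le {x : ℝ} (h0 : 0 ≤ x) (h1 : x ≤ 1) (r : ℕ) : |chebDiff x r| ≤ 3 / 2 :=
  abs_le_of_sq_le_sq (by nlinarith [sq_chebDiff_le h0 h1 r]) (by norm_num)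

/-- The differences telescope: the sum over `range r` is the Chebyshev polynomial `U_{r-1}`, which
obeys the same recurrence. -/
theorem sum_chebDiff_rec (x : ℝ) (r : ℕ) :
    ∑ k ∈ Finset.range (r + 2), chebDiff x k =
      2 * x * ∑ k ∈ Finset.range (r + 1), chebDiff x k - ∑ k ∈ Finset.range r, chebDiff x k := by
  induction r with
  | zero => simp [Finset.sum_range_succ, chebDiff]
  | succ r ih =>
    rw [Finset.sum_range_succ _ (r + 2), Finset.sum_range_succ _ (r + 1)]
    have h := Finset.sum_range_succ (chebDiff x) r
    rw [Finset.sum_range_succ _ (r + 1)] at ih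
    simp only [chebDiff]
    linear_combination ih + h

/-- The solution of the damped recurrence started at `v₀ = 1`, `v₋₁ = q`. -/
noncomputable def dampedCheb (q x : ℝ) (r : ℕ) : ℝ :=
  chebDiff x r + (1 - q) * ∑ k ∈ Finset.range r, chebDiff x k

theorem dampedCheb_rec (q x : ℝ) (r : ℕ) :
    dampedCheb q x (r + 2) = 2 * x * dampedCheb q x (r + 1) - dampedCheb q x r := by
  simp only [dampedCheb]
  rw [sum_chebDiff_rec]
  simp only [chebDiff]; ring

theorem abs_dampedCheb_le {q x : ℝ} (hq : q ≤ 1) (h0 : 0 ≤ x) (h1 : x ≤ 1) (r : ℕ) :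
    |dampedCheb q x r| ≤ 3 / 2 * (1 + (1 - q) * r) := by
  have hs : |∑ k ∈ Finset.range r, chebDiff x k| ≤ r * (3 / 2) := by
    calc _ ≤ ∑ k ∈ Finset.range r, |chebDiff x k| := Finset.abs_sum_le_sum_abs _ _
      _ ≤ ∑ k ∈ Finset.range r, (3 / 2 : ℝ) :=
          Finset.sum_le_sum fun k _ => abs_chebDiff_le h0 h1 k
      _ = _ := by simp
  calc |dampedCheb q x r|
      ≤ |chebDiff x r| + |(1 - q) * ∑ k ∈ Finset.range r, chebDiff x k| := abs_add_le _ _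
    _ = |chebDiff x r| + (1 - q) * |∑ k ∈ Finset.range r, chebDiff x k| := by
        rw [abs_mul, abs_of_nonneg (by linarith : 0 ≤ 1 - q)]
    _ ≤ 3 / 2 + (1 - q) * (r * (3 / 2)) := by
        gcongr
        exact abs_chebDiff_le h0 h1 r
    _ = _ := by ring

/-- With `y = (1 - q) r`, the power decays like `exp(-y)` and the other factor grows like `1 + y ≤ 2
exp(y/2)`, so half of the exponent pays for the linear growth. -/
theorem pow_mul_dampedCheb_le {q x s : ℝ} (hq0 : 0 ≤ q) (hqs : q ≤ 1 - s) (hs : 0 ≤ s)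
    (h0 : 0 ≤ x) (h1 : x ≤ 1) (r : ℕ) :
    |q ^ r * dampedCheb q x r| ≤ 3 * Real.exp (-(r * s / 2)) := by
  have hq1 : q ≤ 1 := by linarith
  have hv := abs_dampedCheb_le hq1 h0 h1 r
  have hy : 0 ≤ (1 - q) * r := mul_nonneg (by linarith) (Nat.cast_nonneg _)
  have hq : q ^ r ≤ Real.exp (-((1 - q) * r)) := by
    calc q ^ r ≤ Real.exp (-(1 - q)) ^ r := by
          gcongr; linarith [Real.add_one_le_exp (-(1 - q))]
      _ = _ := by rw [← Real.exp_nat_mul]; ring_nf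
  have he : 1 + (1 - q) * r ≤ 2 * Real.exp ((1 - q) * r / 2) := by
    linarith [Real.add_one_le_exp ((1 - q) * r / 2)]
  rw [abs_mul, abs_of_nonneg (pow_nonneg hq0 r)]
  calc q ^ r * |dampedCheb q x r|
      ≤ Real.exp (-((1 - q) * r)) * (3 / 2 * (2 * Real.exp ((1 - q) * r / 2))) := by
        gcongr; linarith
    _ = 3 * (Real.exp (-((1 - q) * r)) * Real.exp ((1 - q) * r / 2)) := by ring
    _ = 3 * Real.exp (-((1 - q) * r / 2)) := by rw [← Real.exp_add]; ring_nf
    _ ≤ _ := by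
        gcongr 3 * Real.exp (-(?_ / 2))
        nlinarith [(Nat.cast_nonneg r : (0 : ℝ) ≤ r)]

/-- The substitution `u r = q ^ r • v r` removes the damping. The first equation encodes `u₋₁ = u₀`,
which becomes `v₋₁ = q v₀`, the start built into `dampedCheb`. -/
theorem damped_recurrence_eq {E : Type*} [AddCommGroup E] [Module ℝ E] {q x : ℝ} {u : ℕ → E}
    (h1 : u 1 = (2 * q * x) • u 0 - q ^ 2 • u 0)
    (h2 : ∀ r, u (r + 2) = (2 * q * x) • u (r + 1) - q ^ 2 • u r) (r : ℕ) :
    u r = (q ^ r * dampedCheb q x r) • u 0 := by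
  suffices h : ∀ r, u r = (q ^ r * dampedCheb q x r) • u 0 ∧
      u (r + 1) = (q ^ (r + 1) * dampedCheb q x (r + 1)) • u 0 from (h r).1
  intro r
  induction r with
  | zero =>
    constructor
    · simp [dampedCheb, chebDiff]
    · rw [h1, ← sub_smul]; congr 1; simp [dampedCheb, chebDiff]; ring
  | succ r ih =>
    refine ⟨ih.2, ?_⟩
    rw [h2 r, ih.1, ih.2, dampedCheb_rec, smul_smul, smul_smul, ← sub_smul]
    congr 1; ring

/-! ### The spectrum of the communication matrix -/

/-- The average of the values held by the nodes. -/
noncomputable def nodeAvg {m : ℕ} {E : Type*} [AddCommGroup E] [Module ℝ E] (z : Fin m → E) : E :=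
  (m : ℝ)⁻¹ • ∑ i, z i

/-- The squared consensus error. -/
noncomputable def devSq {m : ℕ} {E : Type*} [NormedAddCommGroup E] [NormedSpace ℝ E]
    (z : Fin m → E) : ℝ :=
  ∑ i, ‖z i - nodeAvg z‖ ^ 2

/-- The matrix of an orthonormal basis also has orthonormal columns. This makes the spectral
decomposition of `W` usable on families of vectors in `E`, without coordinates in `E`. -/
theorem parseval_smul {m : ℕ} {E : Type*} [NormedAddCommGroup E] [InnerProductSpace ℝ E]
    (b : OrthonormalBasis (Fin m) ℝ (EuclideanSpace ℝ (Fin m))) (w : Fin m → E) :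
    ∑ k, ‖∑ i, b k i • w i‖ ^ 2 = ∑ i, ‖w i‖ ^ 2 := by
  have hb : ∀ i j, ∑ k, b k i * b k j = if i = j then 1 else 0 := by
    intro i j
    have := b.sum_inner_mul_inner (EuclideanSpace.single i 1) (EuclideanSpace.single j 1)
    simp only [EuclideanSpace.inner_single_left, EuclideanSpace.inner_single_right] at this
    simp only [map_one, one_mul, conj_trivial] at this
    rw [this]
    simp [eq_comm]
  calc ∑ k, ‖∑ i, b k i • w i‖ ^ 2
      = ∑ k, ∑ i, ∑ j, (b k i * b k j) * inner ℝ (w i) (w j) := by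
        refine Finset.sum_congr rfl fun k _ => ?_
        rw [← real_inner_self_eq_norm_sq, sum_inner]
        refine Finset.sum_congr rfl fun i _ => ?_
        rw [inner_sum]
        refine Finset.sum_congr rfl fun j _ => ?_
        rw [real_inner_smul_left, real_inner_smul_right]; ring
    _ = ∑ i, ∑ j, (∑ k, b k i * b k j) * inner ℝ (w i) (w j) := by
        rw [Finset.sum_comm]
        refine Finset.sum_congr rfl fun i _ => ?_
        rw [Finset.sum_comm]
        refine Finset.sum_congr rfl fun j _ => ?_
        rw [Finset.sum_mul]
    _ = _ := by simp [hb]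

theorem IsCommunicationMatrix.isHermitian {m : ℕ} {G : SimpleGraph (Fin m)}
    {W : Matrix (Fin m) (Fin m) ℝ} (hW : IsCommunicationMatrix G W) : W.IsHermitian :=
  hW.posSemidef.isHermitian

theorem IsCommunicationMatrix.eigenvalues_le_one {m : ℕ} {G : SimpleGraph (Fin m)}
    {W : Matrix (Fin m) (Fin m) ℝ} (hW : IsCommunicationMatrix G W) (k : Fin m) :
    hW.isHermitian.eigenvalues k ≤ 1 := by
  have h1 := hW.le_one.dotProduct_mulVec_nonneg (hW.isHermitian.eigenvectorBasis k)
  rw [Matrix.sub_mulVec, Matrix.one_mulVec, hW.isHermitian.mulVec_eigenvectorBasis] at h1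
  have h2 := hW.isHermitian.eigenvectorBasis.orthonormal.1 k
  have h3 : ‖hW.isHermitian.eigenvectorBasis k‖ ^ 2 = 1 := by rw [h2]; norm_num
  rw [EuclideanSpace.real_norm_sq_eq] at h3
  simp only [dotProduct_sub, dotProduct_smul, star_trivial, smul_eq_mul] at h1
  simp only [dotProduct, ← sq] at h1
  rw [h3] at h1
  linarith

theorem IsCommunicationMatrix.eigenvector_eq {m : ℕ} {G : SimpleGraph (Fin m)}
    {W : Matrix (Fin m) (Fin m) ℝ} (hW : IsCommunicationMatrix G W) {k : Fin m}
    (hk : hW.isHermitian.eigenvalues k = 1) :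
    ∃ a : ℝ, ∀ i, hW.isHermitian.eigenvectorBasis k i = a := by
  have h : (hW.isHermitian.eigenvectorBasis k : Fin m → ℝ) ∈
      LinearMap.ker (1 - W).mulVecLin := by
    rw [LinearMap.mem_ker, Matrix.mulVecLin_apply, Matrix.sub_mulVec, Matrix.one_mulVec,
      hW.isHermitian.mulVec_eigenvectorBasis, hk, one_smul, sub_self]
  rw [hW.ker_eq, Submodule.mem_span_singleton] at h
  obtain ⟨a, ha⟩ := h
  exact ⟨a, fun i => by rw [← ha]; simp⟩

/-- The strict bound is the one-dimensionality of `ker (I - W)`: if `λ₂ ≥ 1`, the two leading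
eigenvectors would both be constant, yet orthogonal unit vectors. -/
theorem IsCommunicationMatrix.lambdaTwo_spec {m : ℕ} (hm : 2 ≤ m) {G : SimpleGraph (Fin m)}
    {W : Matrix (Fin m) (Fin m) ℝ} (hW : IsCommunicationMatrix G W) :
    0 ≤ lambdaTwo W ∧ lambdaTwo W < 1 ∧
      ∃ k₀, (∀ k, k ≠ k₀ → hW.isHermitian.eigenvalues k ≤ lambdaTwo W) := by
  have hc : 1 < Fintype.card (Fin m) := by rw [Fintype.card_fin]; omega
  have hl : lambdaTwo W = hW.isHermitian.eigenvalues₀ ⟨1, hc⟩ := by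
    rw [lambdaTwo, dif_pos ⟨hW.isHermitian, hc⟩]
  -- This is the reindexing by which `eigenvalues` is defined from the sorted `eigenvalues₀`, so the
  -- next identity is definitional.
  let e : Fin (Fintype.card (Fin m)) ≃ Fin m := Fintype.equivOfCardEq (Fintype.card_fin _)
  have he : ∀ k, hW.isHermitian.eigenvalues k = hW.isHermitian.eigenvalues₀ (e.symm k) :=
    fun k => rfl
  have he' : ∀ k, hW.isHermitian.eigenvalues₀ k = hW.isHermitian.eigenvalues (e k) :=
    fun k => by rw [he, Equiv.symm_apply_apply]
  have h0 : hW.isHermitian.eigenvalues₀ ⟨1, hc⟩ ≤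
      hW.isHermitian.eigenvalues₀ ⟨0, by omega⟩ :=
    hW.isHermitian.eigenvalues₀_antitone (by simp [Fin.le_def])
  refine ⟨?_, ?_, e ⟨0, by omega⟩, ?_⟩
  · rw [hl, he']; exact hW.posSemidef.eigenvalues_nonneg _
  · rw [hl]
    by_contra hcon
    push Not at hcon
    have hone : ∀ k, 1 ≤ hW.isHermitian.eigenvalues₀ k → hW.isHermitian.eigenvalues (e k) = 1 :=
      fun k hk => le_antisymm (hW.eigenvalues_le_one _) (by rw [← he']; exact hk)
    obtain ⟨a, ha⟩ := hW.eigenvector_eq (hone _ hcon)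
    obtain ⟨b, hb⟩ := hW.eigenvector_eq (hone _ (hcon.trans h0))
    have hne : e ⟨1, hc⟩ ≠ e ⟨0, by omega⟩ := by
      intro h; simpa using e.injective h
    have hab := hW.isHermitian.eigenvectorBasis.orthonormal.2 hne
    have hna := hW.isHermitian.eigenvectorBasis.orthonormal.1 (e ⟨1, hc⟩)
    have hnb := hW.isHermitian.eigenvectorBasis.orthonormal.1 (e ⟨0, by omega⟩)
    simp only [PiLp.inner_apply, ha, hb, EuclideanSpace.norm_eq, Finset.sum_const,
      Finset.card_univ] at hab hna hnb
    have hm' : m ≠ 0 := by omega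
    simp [hm'] at hab
    rcases hab with h | h <;> simp [h] at hna hnb
  · intro k hk
    rw [hl, he]
    apply hW.isHermitian.eigenvalues₀_antitone
    rw [Fin.le_def]
    by_contra hlt
    apply hk
    rw [← e.apply_symm_apply k]
    congr 1
    ext
    simp at hlt ⊢
    exact hlt

theorem IsCommunicationMatrix.sum_eigenvector_smul {m : ℕ} {G : SimpleGraph (Fin m)}
    {W : Matrix (Fin m) (Fin m) ℝ} (hW : IsCommunicationMatrix G W)
    {E : Type*} [AddCommGroup E] [Module ℝ E] (k : Fin m) (w : Fin m → E) :
    ∑ i, hW.isHermitian.eigenvectorBasis k i • (∑ j, W i j • w j) =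
      hW.isHermitian.eigenvalues k • ∑ i, hW.isHermitian.eigenvectorBasis k i • w i := by
  have h : ∀ j, ∑ i, W i j * hW.isHermitian.eigenvectorBasis k i =
      hW.isHermitian.eigenvalues k * hW.isHermitian.eigenvectorBasis k j := by
    intro j
    have := congrFun (hW.isHermitian.mulVec_eigenvectorBasis k) j
    simp only [Matrix.mulVec, dotProduct, Pi.smul_apply, smul_eq_mul] at this
    rw [← this]
    exact Finset.sum_congr rfl fun i _ => by rw [hW.symm.apply]
  simp only [Finset.smul_sum]
  rw [Finset.sum_comm]
  refine Finset.sum_congr rfl fun j _ => ?_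
  rw [smul_smul, ← h j, Finset.sum_smul]
  exact Finset.sum_congr rfl fun i _ => by rw [smul_smul, mul_comm]

theorem IsCommunicationMatrix.col_sum {m : ℕ} {G : SimpleGraph (Fin m)}
    {W : Matrix (Fin m) (Fin m) ℝ} (hW : IsCommunicationMatrix G W) (j : Fin m) :
    ∑ i, W i j = 1 := by
  have := congrFun hW.transpose_mulVec_one j
  simpa [Matrix.mulVec, dotProduct] using this

theorem IsCommunicationMatrix.row_sum {m : ℕ} {G : SimpleGraph (Fin m)}
    {W : Matrix (Fin m) (Fin m) ℝ} (hW : IsCommunicationMatrix G W) (i : Fin m) :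
    ∑ j, W i j = 1 := by
  have := congrFun hW.mulVec_one i
  simpa [Matrix.mulVec, dotProduct] using this

/-- The coefficient of a sum-zero family along the leading eigenvector vanishes. -/
theorem IsCommunicationMatrix.coeff_eq_zero {m : ℕ} {G : SimpleGraph (Fin m)}
    {W : Matrix (Fin m) (Fin m) ℝ} (hW : IsCommunicationMatrix G W)
    {E : Type*} [AddCommGroup E] [Module ℝ E] {k₀ : Fin m}
    (hk₀ : ∀ k, k ≠ k₀ → hW.isHermitian.eigenvalues k < 1)
    {w : Fin m → E} (hw : ∑ i, w i = 0) :
    ∑ i, hW.isHermitian.eigenvectorBasis k₀ i • w i = 0 := by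
  set b := hW.isHermitian.eigenvectorBasis
  have hsum : ∀ k, k ≠ k₀ → ∑ i, b k i = 0 := by
    intro k hk
    have h := hW.sum_eigenvector_smul k (fun _ => (1 : ℝ))
    simp only [smul_eq_mul, mul_one, hW.row_sum] at h
    have : (1 - hW.isHermitian.eigenvalues k) * ∑ i, b k i = 0 := by
      rw [sub_mul, one_mul, ← h, sub_self]
    rcases mul_eq_zero.1 this with h' | h'
    · linarith [hk₀ k hk]
    · exact h'
  -- The all-ones vector is orthogonal to every `b k` with `k ≠ k₀`, so it is a multiple of `b k₀`.
  -- Hence `b k₀` has constant coordinates, and pairing with it is a multiple of summation.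
  let one : EuclideanSpace ℝ (Fin m) := WithLp.toLp 2 (fun _ => (1 : ℝ))
  have hrep : one = (∑ i, b k₀ i) • b k₀ := by
    rw [← b.sum_repr' one]
    have hin : ∀ k, inner ℝ (b k) one = ∑ i, b k i := by
      intro k; simp [PiLp.inner_apply, one]
    simp only [hin]
    rw [Finset.sum_eq_single k₀]
    · intro k _ hk; rw [hsum k hk, zero_smul]
    · simp
  have hcoord : ∀ i, (1 : ℝ) = (∑ i, b k₀ i) * b k₀ i := by
    intro i
    have := congrArg (fun v : EuclideanSpace ℝ (Fin m) => v i) hrep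
    simpa [one] using this
  have hne : (∑ i, b k₀ i) ≠ 0 := by
    intro h0
    have := hcoord k₀
    rw [h0] at this; simp at this
  have : (∑ i, b k₀ i) • ∑ i, b k₀ i • w i = 0 := by
    rw [Finset.smul_sum]
    simp only [smul_smul, ← hcoord, one_smul]
    exact hw
  exact (smul_eq_zero.1 this).resolve_left hne

/-- One communication round of `FastMix` on a sequence, with its spectral contraction. -/
theorem IsCommunicationMatrix.sum_sq_accelerated_le {m : ℕ} (hm : 2 ≤ m)
    {G : SimpleGraph (Fin m)}
    {W : Matrix (Fin m) (Fin m) ℝ} (hW : IsCommunicationMatrix G W)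
    {E : Type*} [NormedAddCommGroup E] [InnerProductSpace ℝ E] {w : ℕ → Fin m → E}
    (h0 : ∑ i, w 0 i = 0)
    (h1 : ∀ i, w 1 i = (1 + mixMomentum W) • (∑ j, W i j • w 0 j) - mixMomentum W • w 0 i)
    (h2 : ∀ r i, w (r + 2) i =
      (1 + mixMomentum W) • (∑ j, W i j • w (r + 1) j) - mixMomentum W • w r i) (r : ℕ) :
    ∑ i, ‖w r i‖ ^ 2 ≤ (3 * Real.exp (-(r * √(spectralGap W) / 2))) ^ 2 * ∑ i, ‖w 0 i‖ ^ 2 := by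
  obtain ⟨hl0, hl1, k₀, hk₀⟩ := hW.lambdaTwo_spec hm
  set l := lambdaTwo W with hl
  set b := hW.isHermitian.eigenvectorBasis
  set s := √(1 - l ^ 2)
  have hs2 : s ^ 2 = 1 - l ^ 2 := Real.sq_sqrt (by nlinarith)
  have hs0 : 0 ≤ s := Real.sqrt_nonneg _
  have hs1 : s ≤ 1 := by nlinarith
  have hth : mixMomentum W = (1 - s) / (1 + s) := rfl
  set q := √(mixMomentum W)
  have hth0 : 0 ≤ mixMomentum W := by rw [hth]; exact div_nonneg (by linarith) (by linarith)
  have hq0 : 0 ≤ q := Real.sqrt_nonneg _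
  have hq2 : q ^ 2 = mixMomentum W := Real.sq_sqrt hth0
  -- The momentum is chosen for this identity: it puts the recurrence for eigenvalue `λ₂` exactly at
  -- critical damping, `x = 1`.
  have hql : (1 + q ^ 2) * l = 2 * q := by
    have hq1 : q ^ 2 = (1 - s) / (1 + s) := by rw [hq2, hth]
    have : ((1 + q ^ 2) * l) ^ 2 = (2 * q) ^ 2 := by
      have hne : (1 + s) ≠ 0 := by linarith
      rw [mul_pow, mul_pow, hq1]
      field_simp
      nlinarith
    exact (sq_eq_sq₀ (by positivity) (by positivity)).1 this
  have hqlt : q ≤ 1 := by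
    have : q ^ 2 ≤ 1 := by
      rw [hq2, hth, div_le_one (by linarith)]; linarith
    nlinarith
  -- The identity `(1 - λ₂)(1 + q²) = (1 - q)²` gives `1 - q ≥ √χ`; this square root is the
  -- acceleration.
  have hqs : q ≤ 1 - √(spectralGap W) := by
    have : √(spectralGap W) ≤ 1 - q := by
      apply Real.sqrt_le_iff.2 ⟨by linarith, ?_⟩
      show 1 - l ≤ _
      have : (1 - l) * (1 + q ^ 2) = (1 - q) ^ 2 := by linear_combination -hql
      nlinarith [mul_nonneg (by linarith : 0 ≤ 1 - l) (sq_nonneg q)]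
    linarith
  have hcoef : ∀ k, ‖∑ i, b k i • w r i‖ ≤
      3 * Real.exp (-(r * √(spectralGap W) / 2)) * ‖∑ i, b k i • w 0 i‖ := by
    intro k
    by_cases hk : k = k₀
    · subst hk
      have hlt : ∀ k', k' ≠ k → hW.isHermitian.eigenvalues k' < 1 :=
        fun k' h => (hk₀ k' h).trans_lt hl1
      -- Sums stay zero because `W` has unit column sums. This disposes of `k₀`, the only index
      -- whose eigenvalue is not bounded by `λ₂`.
      have hz : ∀ r, ∑ i, w r i = 0 ∧ ∑ i, w (r + 1) i = 0 := by
        have hWs : ∀ v : Fin m → E, ∑ i, ∑ j, W i j • v j = ∑ i, v i := by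
          intro v
          rw [Finset.sum_comm]
          simp only [← Finset.sum_smul, hW.col_sum, one_smul]
        intro r
        induction r with
        | zero =>
          refine ⟨h0, ?_⟩
          simp only [zero_add, h1, Finset.sum_sub_distrib, ← Finset.smul_sum, hWs, h0, smul_zero,
            sub_zero]
        | succ r ih =>
          refine ⟨ih.2, ?_⟩
          simp only [h2, Finset.sum_sub_distrib, ← Finset.smul_sum, hWs, ih.1, ih.2,
            smul_zero, sub_zero]
      rw [hW.coeff_eq_zero hlt (hz r).1, norm_zero]
      positivity
    · set μ := hW.isHermitian.eigenvalues k
      have hμ0 : 0 ≤ μ := hW.posSemidef.eigenvalues_nonneg k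
      have hμ1 : μ ≤ l := hk₀ k hk
      -- If `λ₂ = 0` then `μ = 0` as well, and any `x` would do.
      obtain ⟨x, hx0, hx1, hx⟩ : ∃ x, 0 ≤ x ∧ x ≤ 1 ∧ μ = l * x := by
        rcases hl0.eq_or_lt with h | h
        · exact ⟨0, le_rfl, zero_le_one, by linarith⟩
        · exact ⟨μ / l, by positivity, (div_le_one h).2 hμ1, by field_simp⟩
      have hmu : (1 + mixMomentum W) * μ = 2 * q * x := by
        rw [← hq2, hx, ← mul_assoc, hql]
      have hstep : ∀ u v : Fin m → E, ∑ i, b k i • ((1 + mixMomentum W) • (∑ j, W i j • u j)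
          - mixMomentum W • v i) =
          (2 * q * x) • ∑ i, b k i • u i - q ^ 2 • ∑ i, b k i • v i := by
        intro u v
        rw [hq2, ← hmu, mul_smul, ← hW.sum_eigenvector_smul k u, Finset.smul_sum,
          Finset.smul_sum, ← Finset.sum_sub_distrib]
        refine Finset.sum_congr rfl fun i _ => ?_
        rw [smul_sub, smul_comm (b k i), smul_comm (b k i) (mixMomentum W)]
      have := damped_recurrence_eq (u := fun r => ∑ i, b k i • w r i) (q := q) (x := x)
        (by simp only [h1, hstep]) (by intro r; simp only [h2, hstep]) r
      simp only at this
      rw [this, norm_smul, Real.norm_eq_abs]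
      gcongr
      exact pow_mul_dampedCheb_le hq0 hqs (Real.sqrt_nonneg _) hx0 hx1 r
  rw [← parseval_smul b, ← parseval_smul b (w 0), Finset.mul_sum]
  refine Finset.sum_le_sum fun k _ => ?_
  rw [← mul_pow]
  gcongr
  exact hcoef k

theorem IsCommunicationMatrix.spectralGap_mem {m : ℕ} (hm : 2 ≤ m) {G : SimpleGraph (Fin m)}
    {W : Matrix (Fin m) (Fin m) ℝ} (hW : IsCommunicationMatrix G W) :
    0 < spectralGap W ∧ spectralGap W ≤ 1 := by
  obtain ⟨h0, h1, -⟩ := hW.lambdaTwo_spec hm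
  constructor <;> rw [spectralGap] <;> linarith

/-! ### `FastMix` -/

theorem fastMix_rounds {m d : ℕ} (W : Matrix (Fin m) (Fin m) ℝ)
    (φ : Fin m → EuclideanSpace ℝ (Fin d)) (r : ℕ) : (fastMix W φ r).rounds = r := by
  induction r with
  | zero => rfl
  | succ r ih => simp [fastMix, mixRound, ih]

theorem sum_mixRound {m d : ℕ} {G : SimpleGraph (Fin m)}
    {W : Matrix (Fin m) (Fin m) ℝ} (hW : IsCommunicationMatrix G W) (q : MixState m d)
    (h : ∑ i, q.prev i = ∑ i, q.cur i) :
    ∑ i, (mixRound W q).cur i = ∑ i, q.cur i := by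
  simp only [mixRound, Finset.sum_sub_distrib, ← Finset.smul_sum, h]
  rw [Finset.sum_comm]
  simp only [← Finset.sum_smul, hW.col_sum, one_smul]
  rw [← sub_smul]; simp

theorem nodeAvg_fastMix {m d : ℕ} {G : SimpleGraph (Fin m)}
    {W : Matrix (Fin m) (Fin m) ℝ} (hW : IsCommunicationMatrix G W)
    (φ : Fin m → EuclideanSpace ℝ (Fin d)) (r : ℕ) :
    nodeAvg (fastMix W φ r).cur = nodeAvg φ := by
  have h : ∀ r, ∑ i, (fastMix W φ r).cur i = ∑ i, φ i ∧
      ∑ i, (fastMix W φ r).prev i = ∑ i, φ i := by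
    intro r
    induction r with
    | zero => exact ⟨rfl, rfl⟩
    | succ r ih =>
      refine ⟨?_, ih.1⟩
      rw [fastMix, sum_mixRound hW _ (ih.2.trans ih.1.symm), ih.1]
  rw [nodeAvg, (h r).1, nodeAvg]

/-- Unit row sums make the recurrence commute with subtracting a constant vector, and the average is
invariant, so the deviations form a sum-zero solution of the same recurrence. -/
theorem devSq_fastMix_le {m d : ℕ} (hm : 2 ≤ m) {G : SimpleGraph (Fin m)}
    {W : Matrix (Fin m) (Fin m) ℝ} (hW : IsCommunicationMatrix G W)
    (φ : Fin m → EuclideanSpace ℝ (Fin d)) (r : ℕ) :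
    devSq (fastMix W φ r).cur ≤
      (3 * Real.exp (-(r * √(spectralGap W) / 2))) ^ 2 * devSq φ := by
  have hm0 : (m : ℝ) ≠ 0 := by positivity
  have hstep : ∀ (u v : Fin m → EuclideanSpace ℝ (Fin d)) (a : EuclideanSpace ℝ (Fin d)) i,
      (1 + mixMomentum W) • (∑ j, W i j • u j) - mixMomentum W • v i - a =
      (1 + mixMomentum W) • (∑ j, W i j • (u j - a)) - mixMomentum W • (v i - a) := by
    intro u v a i
    simp only [smul_sub, Finset.sum_sub_distrib, ← Finset.sum_smul, hW.row_sum]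
    module
  have := hW.sum_sq_accelerated_le hm
    (w := fun r i => (fastMix W φ r).cur i - nodeAvg φ) ?_ ?_ ?_ r
  · rw [devSq, nodeAvg_fastMix hW]
    exact this
  · simp only [fastMix, Finset.sum_sub_distrib, Finset.sum_const, Finset.card_univ,
      Fintype.card_fin, nodeAvg, ← Nat.cast_smul_eq_nsmul ℝ, smul_smul, mul_inv_cancel₀ hm0,
      one_smul, sub_self]
  · intro i
    rw [← hstep]; rfl
  · intro r i
    rw [← hstep]; rfl

/-! ### Smooth functions -/

theorem SmoothWith.lipschitzWith {d : ℕ} {K : ℝ} {h : EuclideanSpace ℝ (Fin d) → ℝ}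
    (hh : SmoothWith K h) : LipschitzWith (Real.toNNReal |K|) (gradient h) := by
  refine LipschitzWith.of_dist_le_mul fun x y => ?_
  rw [Real.coe_toNNReal _ (abs_nonneg K), dist_eq_norm, dist_eq_norm]
  apply le_of_sq_le_sq _ (by positivity)
  rw [mul_pow, sq_abs]
  exact hh.lipschitz x y

theorem SmoothWith.continuous_gradient {d : ℕ} {K : ℝ} {h : EuclideanSpace ℝ (Fin d) → ℝ}
    (hh : SmoothWith K h) : Continuous (gradient h) := hh.lipschitzWith.continuous

theorem SmoothWith.measurable_gradient {d : ℕ} {K : ℝ} {h : EuclideanSpace ℝ (Fin d) → ℝ}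
    (hh : SmoothWith K h) : Measurable (gradient h) := hh.continuous_gradient.measurable

/-- Along the segment, `h` minus its quadratic upper model has nonpositive derivative, so it is no
larger at `t = 1` than at `t = 0`. -/
theorem SmoothWith.descent {d : ℕ} {K : ℝ} (hK : 0 ≤ K) {h : EuclideanSpace ℝ (Fin d) → ℝ}
    (hh : SmoothWith K h) (x v : EuclideanSpace ℝ (Fin d)) :
    h (x + v) ≤ h x + inner ℝ (gradient h x) v + K / 2 * ‖v‖ ^ 2 := by
  have hderiv : ∀ t : ℝ, HasDerivAt (fun t : ℝ => h (x + t • v))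
      (inner ℝ (gradient h (x + t • v)) v) t := by
    intro t
    have h1 : HasFDerivAt h (InnerProductSpace.toDual ℝ _ (gradient h (x + t • v))) (x + t • v) :=
      (hh.differentiable _).hasGradientAt.hasFDerivAt
    have h2 : HasDerivAt (fun t : ℝ => x + t • v) v t := by
      simpa using ((hasDerivAt_id t).smul_const v).const_add x
    exact (h1.comp_hasDerivAt t h2).congr_deriv (by simp)
  have hlip : ∀ t : ℝ, 0 ≤ t → inner ℝ (gradient h (x + t • v)) v ≤
      inner ℝ (gradient h x) v + K * t * ‖v‖ ^ 2 := by
    intro t ht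
    have h1 : ‖gradient h (x + t • v) - gradient h x‖ ≤ K * t * ‖v‖ := by
      apply le_of_sq_le_sq _ (by positivity)
      calc _ ≤ K ^ 2 * ‖x + t • v - x‖ ^ 2 := hh.lipschitz _ _
        _ = _ := by rw [add_sub_cancel_left, norm_smul, Real.norm_of_nonneg ht]; ring
    have h2 := real_inner_le_norm (gradient h (x + t • v) - gradient h x) v
    rw [inner_sub_left] at h2
    nlinarith [mul_le_mul_of_nonneg_right h1 (norm_nonneg v)]
  let φ : ℝ → ℝ := fun t =>
    h (x + t • v) - t * inner ℝ (gradient h x) v - K / 2 * t ^ 2 * ‖v‖ ^ 2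
  have hφ : ∀ t : ℝ, HasDerivAt φ (inner ℝ (gradient h (x + t • v)) v
      - inner ℝ (gradient h x) v - K * t * ‖v‖ ^ 2) t := by
    intro t
    have h1 := ((hderiv t).sub ((hasDerivAt_id t).mul_const (inner ℝ (gradient h x) v))).sub
      ((((hasDerivAt_id t).pow 2).const_mul (K / 2)).mul_const (‖v‖ ^ 2))
    refine h1.congr_deriv ?_
    simp only [id]; push_cast; ring
  have hanti : AntitoneOn φ (Set.Icc 0 1) := by
    apply antitoneOn_of_deriv_nonpos (convex_Icc 0 1)
    · exact fun t _ => (hφ t).continuousAt.continuousWithinAt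
    · exact fun t _ => (hφ t).differentiableAt.differentiableWithinAt
    · intro t ht
      rw [interior_Icc] at ht
      rw [(hφ t).deriv]
      linarith [hlip t ht.1.le]
  have := hanti (by simp) (by simp) (zero_le_one (α := ℝ))
  simp only [φ, one_smul, zero_smul, add_zero] at this
  linarith

/-! ### A single stochastic gradient -/

section Oracle

variable {Ω : Type*} [MeasurableSpace Ω] {P : Measure Ω} {d : ℕ} {X : Type*} [MeasurableSpace X]
  {D : Measure X} {g : EuclideanSpace ℝ (Fin d) → X → EuclideanSpace ℝ (Fin d)}
  {h : EuclideanSpace ℝ (Fin d) → ℝ} {σ K : ℝ}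

theorem IsStochasticGradient.lintegral_le [IsProbabilityMeasure D]
    (hg : IsStochasticGradient D g h σ) (x : EuclideanSpace ℝ (Fin d)) :
    ∫⁻ z, ‖g x z - gradient h x‖ₑ ^ 2 ∂D ≤ ENNReal.ofReal (σ ^ 2) := by
  have hL : MemLp (fun z => g x z - gradient h x) 2 D := (hg.memLp x).sub (memLp_const _)
  have hi := (memLp_two_iff_integrable_sq_norm hL.1).1 hL
  calc ∫⁻ z, ‖g x z - gradient h x‖ₑ ^ 2 ∂D
      = ∫⁻ z, ENNReal.ofReal (‖g x z - gradient h x‖ ^ 2) ∂D := by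
        refine lintegral_congr fun z => ?_
        rw [ENNReal.ofReal_pow (norm_nonneg _), ofReal_norm]
    _ = ENNReal.ofReal (∫ z, ‖g x z - gradient h x‖ ^ 2 ∂D) :=
        (ofReal_integral_eq_lintegral_ofReal hi (ae_of_all _ fun _ => by positivity)).symm
    _ ≤ _ := ENNReal.ofReal_le_ofReal (hg.variance_le x)

/-- By independence the joint law is a product, and the variance bound holds for each frozen point.
Working with `lintegral` lets Tonelli yield integrability and the bound together. -/
theorem IsStochasticGradient.memLp_noise [IsProbabilityMeasure P] [IsProbabilityMeasure D]
    (hg : IsStochasticGradient D g h σ) (hh : SmoothWith K h)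
    {Y : Ω → X} (hY : Measurable Y) (hlaw : P.map Y = D)
    {x : Ω → EuclideanSpace ℝ (Fin d)} (hx : Measurable x) (hind : IndepFun x Y P) :
    MemLp (fun ω => g (x ω) (Y ω) - gradient h (x ω)) 2 P ∧
      ∫ ω, ‖g (x ω) (Y ω) - gradient h (x ω)‖ ^ 2 ∂P ≤ σ ^ 2 := by
  have hF : Measurable (fun p : EuclideanSpace ℝ (Fin d) × X => g p.1 p.2 - gradient h p.1) :=
    hg.measurable.sub (hh.measurable_gradient.comp measurable_fst)
  have hm : Measurable (fun ω => g (x ω) (Y ω) - gradient h (x ω)) :=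
    hF.comp (hx.prodMk hY)
  have : IsProbabilityMeasure (P.map x) := Measure.isProbabilityMeasure_map hx.aemeasurable
  have hle : ∫⁻ ω, ‖g (x ω) (Y ω) - gradient h (x ω)‖ₑ ^ 2 ∂P ≤ ENNReal.ofReal (σ ^ 2) := by
    have hprod := (indepFun_iff_map_prod_eq_prod_map_map hx.aemeasurable hY.aemeasurable).1 hind
    rw [hlaw] at hprod
    calc _ = ∫⁻ p, ‖g p.1 p.2 - gradient h p.1‖ₑ ^ 2 ∂(P.map fun ω => (x ω, Y ω)) := by
            rw [lintegral_map (hF.enorm.pow_const 2) (hx.prodMk hY)]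
      _ = ∫⁻ a, ∫⁻ z, ‖g a z - gradient h a‖ₑ ^ 2 ∂D ∂(P.map x) := by
            rw [hprod, lintegral_prod _ (hF.enorm.pow_const 2).aemeasurable]
      _ ≤ ∫⁻ a, ENNReal.ofReal (σ ^ 2) ∂(P.map x) := lintegral_mono fun a => hg.lintegral_le a
      _ = _ := by simp
  have hint : Integrable (fun ω => ‖g (x ω) (Y ω) - gradient h (x ω)‖ ^ 2) P := by
    refine ⟨(hm.norm.pow_const 2).aestronglyMeasurable, ?_⟩
    refine lt_of_le_of_lt (le_of_eq ?_) (hle.trans_lt ENNReal.ofReal_lt_top)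
    refine lintegral_congr fun z => ?_
    rw [enorm_pow, enorm_norm]
  refine ⟨(memLp_two_iff_integrable_sq_norm hm.aestronglyMeasurable).2 hint, ?_⟩
  rw [integral_eq_lintegral_of_nonneg_ae (ae_of_all _ fun _ => by positivity) hint.1]
  apply ENNReal.toReal_le_of_le_ofReal (sq_nonneg σ)
  refine le_trans (le_of_eq ?_) hle
  refine lintegral_congr fun z => ?_
  rw [ENNReal.ofReal_pow (norm_nonneg _), ofReal_norm]

theorem integrable_inner_of_memLp {E : Type*} [NormedAddCommGroup E] [InnerProductSpace ℝ E]
    {u v : Ω → E} (hu : MemLp u 2 P) (hv : MemLp v 2 P) :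
    Integrable (fun ω => inner ℝ (u ω) (v ω)) P := by
  refine Integrable.mono' ((hu.norm.integrable_mul hv.norm)) (hu.1.inner hv.1) ?_
  exact ae_of_all _ fun ω => norm_inner_le_norm _ _

theorem integrable_sq_norm {E : Type*} [NormedAddCommGroup E]
    {u : Ω → E} (hu : MemLp u 2 P) : Integrable (fun ω => ‖u ω‖ ^ 2) P :=
  (memLp_two_iff_integrable_sq_norm hu.1).1 hu

/-- Freeze the pair `(x, Z)`: by Fubini the integral over the fresh sample is `⟨Z, E g - ∇h⟩ = 0`.
-/
theorem IsStochasticGradient.integral_inner_noise [IsProbabilityMeasure P]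
    [IsProbabilityMeasure D]
    (hg : IsStochasticGradient D g h σ) (hh : SmoothWith K h)
    {Y : Ω → X} (hY : Measurable Y) (hlaw : P.map Y = D)
    {x Z : Ω → EuclideanSpace ℝ (Fin d)} (hx : Measurable x) (hZ : Measurable Z)
    (hind : IndepFun (fun ω => (x ω, Z ω)) Y P) (hZL : MemLp Z 2 P) :
    ∫ ω, inner ℝ (Z ω) (g (x ω) (Y ω) - gradient h (x ω)) ∂P = 0 := by
  have hxZ : Measurable fun ω => (x ω, Z ω) := hx.prodMk hZ
  have hindx : IndepFun x Y P := hind.comp measurable_fst measurable_id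
  have hn := (hg.memLp_noise hh hY hlaw hx hindx).1
  have hF : Measurable (fun p : (EuclideanSpace ℝ (Fin d) × EuclideanSpace ℝ (Fin d)) × X =>
      inner ℝ p.1.2 (g p.1.1 p.2 - gradient h p.1.1)) := by
    refine Measurable.inner (by fun_prop) (Measurable.sub ?_ ?_)
    · exact hg.measurable.comp ((measurable_fst.comp measurable_fst).prodMk measurable_snd)
    · exact hh.measurable_gradient.comp (by fun_prop)
  have hprod := (indepFun_iff_map_prod_eq_prod_map_map hxZ.aemeasurable hY.aemeasurable).1 hind
  rw [hlaw] at hprod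
  have : IsProbabilityMeasure (P.map fun ω => (x ω, Z ω)) :=
    Measure.isProbabilityMeasure_map hxZ.aemeasurable
  have hint : Integrable (fun p : (EuclideanSpace ℝ (Fin d) × EuclideanSpace ℝ (Fin d)) × X =>
      inner ℝ p.1.2 (g p.1.1 p.2 - gradient h p.1.1))
      ((P.map fun ω => (x ω, Z ω)).prod D) := by
    rw [← hprod, integrable_map_measure hF.aestronglyMeasurable (hxZ.prodMk hY).aemeasurable]
    exact integrable_inner_of_memLp hZL hn
  have hmap := integral_map (μ := P) (hxZ.prodMk hY).aemeasurable
    (f := fun p : (EuclideanSpace ℝ (Fin d) × EuclideanSpace ℝ (Fin d)) × X =>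
      (inner ℝ p.1.2 (g p.1.1 p.2 - gradient h p.1.1) : ℝ)) hF.aestronglyMeasurable
  rw [← hmap, hprod, integral_prod _ hint]
  refine integral_eq_zero_of_ae (ae_of_all _ fun p => ?_)
  have hgi : Integrable (g p.1) D := (hg.memLp p.1).integrable (by norm_num)
  show ∫ z, inner ℝ p.2 (g p.1 z - gradient h p.1) ∂D = 0
  have hgs : Integrable (fun z => g p.1 z - gradient h p.1) D := hgi.sub (integrable_const _)
  rw [integral_inner hgs, integral_sub hgi (integrable_const _), hg.unbiased]
  simp

end Oracle

/-- Pythagoras for pairwise orthogonal square integrable random vectors. -/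
theorem integral_sq_norm_sum_of_orthogonal {Ω : Type*} [MeasurableSpace Ω] {P : Measure Ω}
    {E : Type*} [NormedAddCommGroup E] [InnerProductSpace ℝ E] {ι : Type*}
    (s : Finset ι) (v : ι → Ω → E) (hv : ∀ k ∈ s, MemLp (v k) 2 P)
    (ho : ∀ k ∈ s, ∀ l ∈ s, k ≠ l → ∫ ω, inner ℝ (v k ω) (v l ω) ∂P = 0) :
    ∫ ω, ‖∑ k ∈ s, v k ω‖ ^ 2 ∂P = ∑ k ∈ s, ∫ ω, ‖v k ω‖ ^ 2 ∂P := by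
  calc ∫ ω, ‖∑ k ∈ s, v k ω‖ ^ 2 ∂P
      = ∫ ω, ∑ k ∈ s, ∑ l ∈ s, inner ℝ (v k ω) (v l ω) ∂P := by
        refine integral_congr_ae (ae_of_all _ fun ω => ?_)
        simp only
        rw [← real_inner_self_eq_norm_sq, sum_inner]
        exact Finset.sum_congr rfl fun k _ => inner_sum _ _ _
    _ = ∑ k ∈ s, ∑ l ∈ s, ∫ ω, inner ℝ (v k ω) (v l ω) ∂P := by
        rw [integral_finsetSum _ fun k hk => integrable_finsetSum _ fun l hl =>
          integrable_inner_of_memLp (hv k hk) (hv l hl)]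
        exact Finset.sum_congr rfl fun k hk => integral_finsetSum _ fun l hl =>
          integrable_inner_of_memLp (hv k hk) (hv l hl)
    _ = _ := by
        refine Finset.sum_congr rfl fun k hk => ?_
        rw [Finset.sum_eq_single k (fun l hl hne => ho k hk l hl hne.symm) (fun h => absurd hk h)]
        exact integral_congr_ae (ae_of_all _ fun ω => real_inner_self_eq_norm_sq _)

/-! ### Averages and consensus errors -/

section Consensus

variable {m : ℕ} {E : Type*} [NormedAddCommGroup E] [InnerProductSpace ℝ E]

theorem nodeAvg_add (a b : Fin m → E) :
    nodeAvg (fun i => a i + b i) = nodeAvg a + nodeAvg b := by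
  simp [nodeAvg, Finset.sum_add_distrib]

theorem nodeAvg_sub (a b : Fin m → E) :
    nodeAvg (fun i => a i - b i) = nodeAvg a - nodeAvg b := by
  simp [nodeAvg, Finset.sum_sub_distrib, smul_sub]

theorem nodeAvg_smul (c : ℝ) (a : Fin m → E) : nodeAvg (fun i => c • a i) = c • nodeAvg a := by
  rw [nodeAvg, ← Finset.smul_sum, smul_comm, nodeAvg]

theorem nodeAvg_const (hm : m ≠ 0) (a : E) : nodeAvg (fun _ : Fin m => a) = a := by
  have : (m : ℝ) ≠ 0 := by exact_mod_cast hm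
  simp [nodeAvg, ← Nat.cast_smul_eq_nsmul ℝ, smul_smul, this]

theorem devSq_nonneg (z : Fin m → E) : 0 ≤ devSq z :=
  Finset.sum_nonneg fun _ _ => by positivity

theorem devSq_const (hm : m ≠ 0) (a : E) : devSq (fun _ : Fin m => a) = 0 := by
  simp [devSq, nodeAvg_const hm]

theorem sq_norm_sub_nodeAvg_le (z : Fin m → E) (i : Fin m) :
    ‖z i - nodeAvg z‖ ^ 2 ≤ devSq z :=
  Finset.single_le_sum (f := fun i => ‖z i - nodeAvg z‖ ^ 2) (fun _ _ => by positivity)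
    (Finset.mem_univ i)

theorem norm_add_sq_le {E : Type*} [NormedAddCommGroup E] (a b : E) :
    ‖a + b‖ ^ 2 ≤ 2 * ‖a‖ ^ 2 + 2 * ‖b‖ ^ 2 := by
  have := norm_add_le a b
  nlinarith [sq_nonneg (‖a‖ - ‖b‖), norm_nonneg (a + b)]

theorem norm_add_three_sq_le {E : Type*} [NormedAddCommGroup E] (a b c : E) :
    ‖a + b + c‖ ^ 2 ≤ 3 * ‖a‖ ^ 2 + 3 * ‖b‖ ^ 2 + 3 * ‖c‖ ^ 2 := by
  have := norm_add₃_le (a := a) (b := b) (c := c)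
  nlinarith [sq_nonneg (‖a‖ - ‖b‖), sq_nonneg (‖b‖ - ‖c‖), sq_nonneg (‖a‖ - ‖c‖),
    norm_nonneg (a + b + c)]

theorem devSq_add_smul_le (c : ℝ) (a b : Fin m → E) :
    devSq (fun i => a i + c • b i) ≤ 2 * (devSq a + c ^ 2 * devSq b) := by
  rw [devSq, nodeAvg_add, nodeAvg_smul, devSq, devSq, Finset.mul_sum, ← Finset.sum_add_distrib,
    Finset.mul_sum]
  refine Finset.sum_le_sum fun i _ => ?_
  have h := norm_add_sq_le (a i - nodeAvg a) (c • (b i - nodeAvg b))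
  rw [norm_smul, mul_pow, Real.norm_eq_abs, sq_abs] at h
  rw [show a i + c • b i - (nodeAvg a + c • nodeAvg b) =
    a i - nodeAvg a + c • (b i - nodeAvg b) by module]
  linarith

theorem devSq_add_card_mul (hm : m ≠ 0) (z : Fin m → E) :
    devSq z + m * ‖nodeAvg z‖ ^ 2 = ∑ i, ‖z i‖ ^ 2 := by
  have hm' : (m : ℝ) ≠ 0 := by exact_mod_cast hm
  have hs : ∑ i, z i = (m : ℝ) • nodeAvg z := by
    rw [nodeAvg, smul_smul, mul_inv_cancel₀ hm', one_smul]
  have : ∑ i, inner ℝ (z i) (nodeAvg z) = (m : ℝ) * ‖nodeAvg z‖ ^ 2 := by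
    rw [← sum_inner, hs, real_inner_smul_left, real_inner_self_eq_norm_sq]
  simp only [devSq, norm_sub_sq_real, Finset.sum_add_distrib, Finset.sum_sub_distrib,
    ← Finset.mul_sum, this]
  simp
  ring

theorem devSq_le_sum_sq (hm : m ≠ 0) (z : Fin m → E) : devSq z ≤ ∑ i, ‖z i‖ ^ 2 := by
  rw [← devSq_add_card_mul hm]
  have : 0 ≤ (m : ℝ) * ‖nodeAvg z‖ ^ 2 := by positivity
  linarith

theorem sq_norm_nodeAvg_le (hm : m ≠ 0) (z : Fin m → E) :
    ‖nodeAvg z‖ ^ 2 ≤ (m : ℝ)⁻¹ * ∑ i, ‖z i‖ ^ 2 := by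
  have hm' : (0 : ℝ) < m := by positivity
  rw [le_inv_mul_iff₀ hm', ← devSq_add_card_mul hm]
  linarith [devSq_nonneg z]

end Consensus

/-! ### The gradient of the average objective -/

theorem gradient_avgObjective {m d : ℕ} {f : Fin m → EuclideanSpace ℝ (Fin d) → ℝ}
    (hf : ∀ i, Differentiable ℝ (f i)) (x : EuclideanSpace ℝ (Fin d)) :
    gradient (avgObjective f) x = nodeAvg fun i => gradient (f i) x := by
  apply HasGradientAt.gradient
  rw [hasGradientAt_iff_hasFDerivAt]
  have h : HasFDerivAt (fun y => ∑ i, f i y)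
      (∑ i, InnerProductSpace.toDual ℝ _ (gradient (f i) x)) x :=
    HasFDerivAt.fun_sum fun i _ => (hf i x).hasGradientAt.hasFDerivAt
  have h2 := h.const_mul ((m : ℝ)⁻¹)
  refine h2.congr_fderiv ?_
  simp [nodeAvg]

/-- Jensen's inequality with local constants `mL` gives `(mL)²/m = mL²`. The excess factor `m` is
absorbed by the `log m` in the number of mixing rounds. -/
theorem sq_norm_gradient_bias_le {m d : ℕ} (hm : m ≠ 0)
    {f : Fin m → EuclideanSpace ℝ (Fin d) → ℝ} {L : ℝ}
    (hf : ∀ i, SmoothWith ((m : ℝ) * L) (f i)) (x : Fin m → EuclideanSpace ℝ (Fin d)) :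
    ‖gradient (avgObjective f) (nodeAvg x) - nodeAvg fun i => gradient (f i) (x i)‖ ^ 2 ≤
      m * L ^ 2 * devSq x := by
  have hm' : (0 : ℝ) < m := by positivity
  rw [gradient_avgObjective fun i => (hf i).differentiable, ← nodeAvg_sub]
  refine (sq_norm_nodeAvg_le hm _).trans ?_
  calc (m : ℝ)⁻¹ * ∑ i, ‖gradient (f i) (nodeAvg x) - gradient (f i) (x i)‖ ^ 2
      ≤ (m : ℝ)⁻¹ * ∑ i, (m * L) ^ 2 * ‖x i - nodeAvg x‖ ^ 2 := by
        gcongr with i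
        rw [norm_sub_rev (x i)]
        exact (hf i).lipschitz _ _
    _ = _ := by rw [← Finset.mul_sum, devSq]; field_simp

/-! ### One iteration of D-NSS -/

section Step

variable {m d : ℕ} {Ξ : Fin m → Type*}
  {g : ∀ i, EuclideanSpace ℝ (Fin d) → Ξ i → EuclideanSpace ℝ (Fin d)}
  {G : SimpleGraph (Fin m)} {W : Matrix (Fin m) (Fin m) ℝ} {η : ℝ} {B : Fin m → ℕ} {R : ℕ}
  {ξ : ∀ i, ℕ → Ξ i} {q : DNSSState m d}

theorem dnssStep_y (i : Fin m) : (dnssStep g W η B R ξ q).y i =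
    (B i : ℝ)⁻¹ • ∑ j ∈ Finset.range (B i), g i (q.x i) (ξ i j) := rfl

theorem dnssStep_s : (dnssStep g W η B R ξ q).s =
    (fastMix W (fun i => q.s i + (dnssStep g W η B R ξ q).y i - q.y i) R).cur := rfl

theorem dnssStep_x : (dnssStep g W η B R ξ q).x =
    (fastMix W (fun i => q.x i - η • (dnssStep g W η B R ξ q).s i) R).cur := rfl

/-- The invariant of gradient tracking: mixing preserves averages and the increments `y - q.y`
telescope. -/
theorem nodeAvg_dnssStep_s (hW : IsCommunicationMatrix G W) (h : nodeAvg q.s = nodeAvg q.y) :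
    nodeAvg (dnssStep g W η B R ξ q).s = nodeAvg (dnssStep g W η B R ξ q).y := by
  rw [dnssStep_s, nodeAvg_fastMix hW, nodeAvg_sub, nodeAvg_add, h]
  abel

theorem nodeAvg_dnssStep_x (hW : IsCommunicationMatrix G W) :
    nodeAvg (dnssStep g W η B R ξ q).x =
      nodeAvg q.x - η • nodeAvg (dnssStep g W η B R ξ q).s := by
  rw [dnssStep_x, nodeAvg_fastMix hW, nodeAvg_sub, nodeAvg_smul]

theorem devSq_dnssStep_x_le (hm : 2 ≤ m) (hW : IsCommunicationMatrix G W) :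
    devSq (dnssStep g W η B R ξ q).x ≤
      (3 * Real.exp (-(R * √(spectralGap W) / 2))) ^ 2 *
        (2 * (devSq q.x + η ^ 2 * devSq (dnssStep g W η B R ξ q).s)) := by
  rw [dnssStep_x]
  refine (devSq_fastMix_le hm hW _ R).trans ?_
  gcongr
  have := devSq_add_smul_le (-η) q.x (dnssStep g W η B R ξ q).s
  simpa [sub_eq_add_neg] using this

theorem devSq_dnssStep_s_le (hm : 2 ≤ m) (hW : IsCommunicationMatrix G W) :
    devSq (dnssStep g W η B R ξ q).s ≤
      (3 * Real.exp (-(R * √(spectralGap W) / 2))) ^ 2 *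
        (2 * (devSq q.s + ∑ i, ‖(dnssStep g W η B R ξ q).y i - q.y i‖ ^ 2)) := by
  rw [dnssStep_s]
  refine (devSq_fastMix_le hm hW _ R).trans ?_
  gcongr
  have h := devSq_add_smul_le 1 q.s (fun i => (dnssStep g W η B R ξ q).y i - q.y i)
  simp only [one_smul, one_pow, one_mul, ← add_sub_assoc] at h
  have h2 := devSq_le_sum_sq (by omega) (fun i => (dnssStep g W η B R ξ q).y i - q.y i)
  linarith

theorem devSq_dnssStep_s_le_of_zero (hm : 2 ≤ m) (hW : IsCommunicationMatrix G W)
    (hs : q.s = 0) (hy : q.y = 0) :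
    devSq (dnssStep g W η B R ξ q).s ≤
      (3 * Real.exp (-(R * √(spectralGap W) / 2))) ^ 2 *
        ∑ i, ‖(dnssStep g W η B R ξ q).y i‖ ^ 2 := by
  rw [dnssStep_s]
  refine (devSq_fastMix_le hm hW _ R).trans ?_
  gcongr
  refine (devSq_le_sum_sq (by omega) _).trans (le_of_eq ?_)
  simp [hs, hy]

end Step

/-! ### Measurability and integrability of the iterates -/

section Measurability

variable {Ω : Type*} [MeasurableSpace Ω] {m d : ℕ}

theorem measurable_fastMix (W : Matrix (Fin m) (Fin m) ℝ)
    {φ : Ω → Fin m → EuclideanSpace ℝ (Fin d)} (hφ : ∀ i, Measurable fun ω => φ ω i) (r : ℕ) :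
    (∀ i, Measurable fun ω => (fastMix W (φ ω) r).cur i) ∧
      ∀ i, Measurable fun ω => (fastMix W (φ ω) r).prev i := by
  induction r with
  | zero => exact ⟨hφ, hφ⟩
  | succ r ih =>
    refine ⟨fun i => ?_, ih.1⟩
    have h1 := ih.1
    have h2 := ih.2 i
    show Measurable fun ω => (1 + mixMomentum W) • (∑ j, W i j • (fastMix W (φ ω) r).cur j)
      - mixMomentum W • (fastMix W (φ ω) r).prev i
    fun_prop

theorem memLp_fastMix {P : Measure Ω} (W : Matrix (Fin m) (Fin m) ℝ)
    {φ : Ω → Fin m → EuclideanSpace ℝ (Fin d)} (hφ : ∀ i, MemLp (fun ω => φ ω i) 2 P) (r : ℕ) :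
    (∀ i, MemLp (fun ω => (fastMix W (φ ω) r).cur i) 2 P) ∧
      ∀ i, MemLp (fun ω => (fastMix W (φ ω) r).prev i) 2 P := by
  induction r with
  | zero => exact ⟨hφ, hφ⟩
  | succ r ih =>
    refine ⟨fun i => ?_, ih.1⟩
    have h1 : MemLp (fun ω => ∑ j, W i j • (fastMix W (φ ω) r).cur j) 2 P :=
      memLp_finsetSum _ fun j _ => (ih.1 j).const_smul (W i j)
    have h2 : MemLp (fun ω => (1 + mixMomentum W) • ∑ j, W i j • (fastMix W (φ ω) r).cur j) 2 P :=
      h1.const_smul (1 + mixMomentum W)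
    have h3 : MemLp (fun ω => mixMomentum W • (fastMix W (φ ω) r).prev i) 2 P :=
      (ih.2 i).const_smul (mixMomentum W)
    exact h2.sub h3

/-- Only samples before iteration `t` are assumed measurable, and the σ-algebra on `Ω` is arbitrary.
It is later taken to be the one generated by all samples but one, or by the whole sample family. -/
theorem measurable_dnss {Ξ : Fin m → Type*} [∀ i, MeasurableSpace (Ξ i)]
    {g : ∀ i, EuclideanSpace ℝ (Fin d) → Ξ i → EuclideanSpace ℝ (Fin d)}
    (hg : ∀ i, Measurable (Function.uncurry (g i)))
    (W : Matrix (Fin m) (Fin m) ℝ) (η : ℝ) (B : Fin m → ℕ) (R : ℕ → ℕ)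
    (x₀ : EuclideanSpace ℝ (Fin d)) {ξ : ℕ → ∀ i : Fin m, ℕ → Ω → Ξ i} (t : ℕ)
    (hξ : ∀ s < t, ∀ i j, Measurable (ξ s i j)) :
    (∀ i, Measurable fun ω => (dnss g W η B R x₀ (fun t i j => ξ t i j ω) t).x i) ∧
    (∀ i, Measurable fun ω => (dnss g W η B R x₀ (fun t i j => ξ t i j ω) t).s i) ∧
    ∀ i, Measurable fun ω => (dnss g W η B R x₀ (fun t i j => ξ t i j ω) t).y i := by
  induction t with
  | zero => exact ⟨fun _ => measurable_const, fun _ => measurable_const, fun _ => measurable_const⟩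
  | succ t ih =>
    obtain ⟨hx, hs, hy⟩ := ih fun s hst => hξ s (by omega)
    have hy' : ∀ i, Measurable fun ω =>
        (dnss g W η B R x₀ (fun t i j => ξ t i j ω) (t + 1)).y i := by
      intro i
      have hj : ∀ j, Measurable fun ω =>
          g i ((dnss g W η B R x₀ (fun t i j => ξ t i j ω) t).x i) (ξ t i j ω) :=
        fun j => (hg i).comp ((hx i).prodMk (hξ t (by omega) i j))
      exact (Finset.measurable_fun_sum (Finset.range (B i)) fun j _ => hj j).const_smul
        ((B i : ℝ)⁻¹)
    have hs' : ∀ i, Measurable fun ω =>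
        (dnss g W η B R x₀ (fun t i j => ξ t i j ω) (t + 1)).s i := by
      refine (measurable_fastMix W (φ := fun ω i =>
        (dnss g W η B R x₀ (fun t i j => ξ t i j ω) t).s i +
        (dnss g W η B R x₀ (fun t i j => ξ t i j ω) (t + 1)).y i -
        (dnss g W η B R x₀ (fun t i j => ξ t i j ω) t).y i) (fun i => ?_) (R t)).1
      exact ((hs i).add (hy' i)).sub (hy i)
    refine ⟨?_, hs', hy'⟩
    refine (measurable_fastMix W (φ := fun ω i =>
      (dnss g W η B R x₀ (fun t i j => ξ t i j ω) t).x i -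
      η • (dnss g W η B R x₀ (fun t i j => ξ t i j ω) (t + 1)).s i) (fun i => ?_) (R t)).1
    exact (hx i).sub ((hs' i).const_smul η)

theorem SmoothWith.memLp_gradient {P : Measure Ω} [IsFiniteMeasure P] {K : ℝ}
    {h : EuclideanSpace ℝ (Fin d) → ℝ} (hh : SmoothWith K h) {x : Ω → EuclideanSpace ℝ (Fin d)}
    (hx : MemLp x 2 P) : MemLp (fun ω => gradient h (x ω)) 2 P := by
  have h1 : MemLp (fun ω => ‖gradient h 0‖ + |K| * ‖x ω‖) 2 P :=
    (memLp_const ‖gradient h 0‖).add (hx.norm.const_mul |K|)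
  refine h1.of_le (hh.continuous_gradient.comp_aestronglyMeasurable hx.1) (ae_of_all _ fun ω => ?_)
  have h2 := hh.lipschitzWith.dist_le_mul (x ω) 0
  rw [Real.coe_toNNReal _ (abs_nonneg K), dist_eq_norm, dist_zero_right] at h2
  have h3 := norm_le_norm_add_norm_sub' (gradient h (x ω)) (gradient h 0)
  rw [Real.norm_of_nonneg (by positivity)]
  linarith

end Measurability

/-! ### Runs of D-NSS on independent samples -/

/-- `run` is the random trajectory of D-NSS fed with independent samples `ξ t i j ∼ D i`, for
local objectives `f i` with smoothness constants `m L` and stochastic gradients `g i`. -/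
structure IsDNSSRun {m d : ℕ} {Ξ : Fin m → Type*} [∀ i, MeasurableSpace (Ξ i)]
    {Ω : Type*} {mΩ : MeasurableSpace Ω}
    (f : Fin m → EuclideanSpace ℝ (Fin d) → ℝ) (σ : Fin m → ℝ) (L : ℝ) (D : ∀ i, Measure (Ξ i))
    (g : ∀ i, EuclideanSpace ℝ (Fin d) → Ξ i → EuclideanSpace ℝ (Fin d))
    (P : Measure Ω) (ξ : ℕ → ∀ i : Fin m, ℕ → Ω → Ξ i)
    (W : Matrix (Fin m) (Fin m) ℝ) (η : ℝ) (B : Fin m → ℕ) (R : ℕ → ℕ)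
    (x₀ : EuclideanSpace ℝ (Fin d)) (run : Ω → ℕ → DNSSState m d) : Prop where
  smooth : ∀ i, SmoothWith ((m : ℝ) * L) (f i)
  oracle : ∀ i, IsStochasticGradient (D i) (g i) (f i) (σ i)
  measurable_sample : ∀ t i j, Measurable (ξ t i j)
  law_sample : ∀ t i j, P.map (ξ t i j) = D i
  indep_sample : iIndepFun (fun p : ℕ × Fin m × ℕ => ξ p.1 p.2.1 p.2.2) P
  run_eq : run = fun ω => dnss g W η B R x₀ (fun t i j => ξ t i j ω)

/-- The information carried by all samples except the one with index `p`. -/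
@[reducible] def otherSamples {m : ℕ} {Ξ : Fin m → Type*} [∀ i, MeasurableSpace (Ξ i)]
    {Ω : Type*} (ξ : ℕ → ∀ i : Fin m, ℕ → Ω → Ξ i) (p : ℕ × Fin m × ℕ) : MeasurableSpace Ω :=
  ⨆ q ∈ ({p}ᶜ : Set (ℕ × Fin m × ℕ)), MeasurableSpace.comap (ξ q.1 q.2.1 q.2.2) inferInstance

/-- The error of the stochastic gradient of node `i` at iteration `t` for the `j`-th sample. -/
noncomputable def sampleNoise {m d : ℕ} {Ξ : Fin m → Type*} {Ω : Type*}
    (f : Fin m → EuclideanSpace ℝ (Fin d) → ℝ)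
    (g : ∀ i, EuclideanSpace ℝ (Fin d) → Ξ i → EuclideanSpace ℝ (Fin d))
    (ξ : ℕ → ∀ i : Fin m, ℕ → Ω → Ξ i) (run : Ω → ℕ → DNSSState m d)
    (t : ℕ) (i : Fin m) (j : ℕ) (ω : Ω) : EuclideanSpace ℝ (Fin d) :=
  g i ((run ω t).x i) (ξ t i j ω) - gradient (f i) ((run ω t).x i)

/-- The error of the mini-batch gradient of node `i` at iteration `t`. -/
noncomputable def batchNoise {m d : ℕ} {Ω : Type*}
    (f : Fin m → EuclideanSpace ℝ (Fin d) → ℝ) (run : Ω → ℕ → DNSSState m d)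
    (t : ℕ) (ω : Ω) (i : Fin m) : EuclideanSpace ℝ (Fin d) :=
  (run ω (t + 1)).y i - gradient (f i) ((run ω t).x i)

theorem memLp_nodeAvg {m d : ℕ} {Ω : Type*} [MeasurableSpace Ω] {P : Measure Ω}
    {z : Ω → Fin m → EuclideanSpace ℝ (Fin d)}
    (hz : ∀ i, MemLp (fun ω => z ω i) 2 P) : MemLp (fun ω => nodeAvg (z ω)) 2 P := by
  have h : MemLp (fun ω => ∑ i, z ω i) 2 P := memLp_finsetSum _ fun i _ => hz i
  exact h.const_smul ((m : ℝ)⁻¹)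

theorem measurable_sample_other {m : ℕ} {Ξ : Fin m → Type*} [∀ i, MeasurableSpace (Ξ i)]
    {Ω : Type*} {ξ : ℕ → ∀ i : Fin m, ℕ → Ω → Ξ i} (p q : ℕ × Fin m × ℕ) (h : q ≠ p) :
    Measurable[otherSamples ξ p] (ξ q.1 q.2.1 q.2.2) := by
  rw [measurable_iff_comap_le]
  exact le_biSup (fun q : ℕ × Fin m × ℕ =>
    MeasurableSpace.comap (ξ q.1 q.2.1 q.2.2) inferInstance) h

namespace IsDNSSRun

variable {m d : ℕ} {Ξ : Fin m → Type*} [∀ i, MeasurableSpace (Ξ i)]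
    {Ω : Type*} [mΩ : MeasurableSpace Ω]
    {f : Fin m → EuclideanSpace ℝ (Fin d) → ℝ} {σ : Fin m → ℝ} {L : ℝ} {D : ∀ i, Measure (Ξ i)}
    {g : ∀ i, EuclideanSpace ℝ (Fin d) → Ξ i → EuclideanSpace ℝ (Fin d)}
    {P : Measure Ω} {ξ : ℕ → ∀ i : Fin m, ℕ → Ω → Ξ i}
    {W : Matrix (Fin m) (Fin m) ℝ} {η : ℝ} {B : Fin m → ℕ} {R : ℕ → ℕ}
    {x₀ : EuclideanSpace ℝ (Fin d)} {run : Ω → ℕ → DNSSState m d}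

theorem run_zero (H : IsDNSSRun f σ L D g P ξ W η B R x₀ run) (ω : Ω) :
    run ω 0 = ⟨fun _ => x₀, fun _ => 0, fun _ => 0, 0, 0⟩ := by rw [H.run_eq]; rfl

theorem run_succ (H : IsDNSSRun f σ L D g P ξ W η B R x₀ run) (ω : Ω) (t : ℕ) :
    run ω (t + 1) = dnssStep g W η B (R t) (fun i j => ξ t i j ω) (run ω t) := by
  rw [H.run_eq]; rfl

theorem measurable_run (H : IsDNSSRun f σ L D g P ξ W η B R x₀ run) (m' : MeasurableSpace Ω)
    (t : ℕ) (hξ : ∀ s < t, ∀ i j, Measurable[m'] (ξ s i j)) :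
    (∀ i, Measurable[m'] fun ω => (run ω t).x i) ∧ (∀ i, Measurable[m'] fun ω => (run ω t).s i) ∧
      ∀ i, Measurable[m'] fun ω => (run ω t).y i := by
  rw [H.run_eq]
  exact @measurable_dnss Ω m' m d Ξ _ g (fun i => (H.oracle i).measurable) W η B R x₀ ξ t hξ

theorem measurable_x (H : IsDNSSRun f σ L D g P ξ W η B R x₀ run) (t : ℕ) (i : Fin m) :
    Measurable fun ω => (run ω t).x i :=
  (H.measurable_run mΩ t fun s _ i j => H.measurable_sample s i j).1 i

theorem otherSamples_le (H : IsDNSSRun f σ L D g P ξ W η B R x₀ run) (p : ℕ × Fin m × ℕ) :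
    otherSamples ξ p ≤ mΩ :=
  iSup₂_le fun q _ => (H.measurable_sample q.1 q.2.1 q.2.2).comap_le

theorem indepFun_sample (H : IsDNSSRun f σ L D g P ξ W η B R x₀ run)
    (p : ℕ × Fin m × ℕ) {β : Type*} [MeasurableSpace β] {Z : Ω → β}
    (hZ : Measurable[otherSamples ξ p] Z) : IndepFun Z (ξ p.1 p.2.1 p.2.2) P := by
  have h := indep_iSup_of_disjoint
    (m := fun q : ℕ × Fin m × ℕ => MeasurableSpace.comap (ξ q.1 q.2.1 q.2.2) inferInstance)
    (fun q => (H.measurable_sample q.1 q.2.1 q.2.2).comap_le) H.indep_sample.iIndep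
    (S := {p}ᶜ) (T := {p}) disjoint_compl_left
  rw [iSup_singleton] at h
  rw [IndepFun_iff_Indep]
  exact indep_of_indep_of_le_left h (measurable_iff_comap_le.1 hZ)

theorem measurable_x_other (H : IsDNSSRun f σ L D g P ξ W η B R x₀ run) (t : ℕ)
    (i k : Fin m) (j : ℕ) : Measurable[otherSamples ξ (t, k, j)] fun ω => (run ω t).x i :=
  (H.measurable_run _ t fun s hs i j' =>
    measurable_sample_other (t, k, j) (s, i, j') (by simp; omega)).1 i

/-- Thus one sample error may serve as the test vector `Z` for another in the same iteration, which
makes distinct errors orthogonal. -/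
theorem measurable_sampleNoise_other (H : IsDNSSRun f σ L D g P ξ W η B R x₀ run) (t : ℕ)
    {i k : Fin m} {j l : ℕ} (h : (i, j) ≠ (k, l)) :
    Measurable[otherSamples ξ (t, k, l)] (sampleNoise f g ξ run t i j) := by
  have hx := H.measurable_x_other t i k l
  have hs : Measurable[otherSamples ξ (t, k, l)] (ξ t i j) :=
    measurable_sample_other (t, k, l) (t, i, j) (by simpa using h)
  exact ((H.oracle i).measurable.comp (hx.prodMk hs)).sub
    ((H.smooth i).measurable_gradient.comp hx)

theorem batchNoise_eq (H : IsDNSSRun f σ L D g P ξ W η B R x₀ run) (hB : ∀ i, B i ≠ 0)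
    (t : ℕ) (i : Fin m) (ω : Ω) : batchNoise f run t ω i =
      ∑ j ∈ Finset.range (B i), (B i : ℝ)⁻¹ • sampleNoise f g ξ run t i j ω := by
  have hB' : (B i : ℝ) ≠ 0 := by exact_mod_cast hB i
  rw [batchNoise, H.run_succ, dnssStep_y, ← Finset.smul_sum]
  simp only [sampleNoise, Finset.sum_sub_distrib, Finset.sum_const, Finset.card_range, smul_sub,
    ← Nat.cast_smul_eq_nsmul ℝ, smul_smul, inv_mul_cancel₀ hB', one_smul]

theorem nodeAvg_batchNoise_eq (H : IsDNSSRun f σ L D g P ξ W η B R x₀ run) (hB : ∀ i, B i ≠ 0)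
    (t : ℕ) (ω : Ω) : nodeAvg (batchNoise f run t ω) =
      ∑ k ∈ (Finset.univ : Finset (Fin m)).sigma fun i => Finset.range (B i),
        ((m : ℝ)⁻¹ * (B k.1 : ℝ)⁻¹) • sampleNoise f g ξ run t k.1 k.2 ω := by
  rw [Finset.sum_sigma, nodeAvg]
  simp only [H.batchNoise_eq hB, ← Finset.smul_sum, mul_smul]

variable [IsProbabilityMeasure P] [∀ i, IsProbabilityMeasure (D i)]

theorem memLp_sampleNoise (H : IsDNSSRun f σ L D g P ξ W η B R x₀ run) (t : ℕ) (i : Fin m)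
    (j : ℕ) : MemLp (sampleNoise f g ξ run t i j) 2 P ∧
      ∫ ω, ‖sampleNoise f g ξ run t i j ω‖ ^ 2 ∂P ≤ σ i ^ 2 :=
  (H.oracle i).memLp_noise (H.smooth i) (H.measurable_sample t i j) (H.law_sample t i j)
    (H.measurable_x t i) (H.indepFun_sample (t, i, j) (H.measurable_x_other t i i j))

theorem integral_inner_sampleNoise (H : IsDNSSRun f σ L D g P ξ W η B R x₀ run) (t : ℕ)
    (i : Fin m) (j : ℕ) {Z : Ω → EuclideanSpace ℝ (Fin d)}
    (hZ : Measurable[otherSamples ξ (t, i, j)] Z) (hZL : MemLp Z 2 P) :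
    ∫ ω, inner ℝ (Z ω) (sampleNoise f g ξ run t i j ω) ∂P = 0 :=
  (H.oracle i).integral_inner_noise (H.smooth i) (H.measurable_sample t i j) (H.law_sample t i j)
    (H.measurable_x t i) (hZ.mono (H.otherSamples_le _) le_rfl)
    (H.indepFun_sample (t, i, j) ((H.measurable_x_other t i i j).prodMk hZ)) hZL

/-- Variance of a linear combination of distinct sample errors of one iteration. -/
theorem integral_sq_norm_sum_sampleNoise_le (H : IsDNSSRun f σ L D g P ξ W η B R x₀ run) (t : ℕ)
    (s : Finset (Σ _ : Fin m, ℕ)) (c : (Σ _ : Fin m, ℕ) → ℝ) :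
    ∫ ω, ‖∑ k ∈ s, c k • sampleNoise f g ξ run t k.1 k.2 ω‖ ^ 2 ∂P ≤
      ∑ k ∈ s, c k ^ 2 * σ k.1 ^ 2 := by
  rw [integral_sq_norm_sum_of_orthogonal s
    (fun k ω => c k • sampleNoise f g ξ run t k.1 k.2 ω)]
  · refine Finset.sum_le_sum fun k _ => ?_
    simp only [norm_smul, mul_pow, Real.norm_eq_abs, sq_abs]
    rw [integral_const_mul]
    gcongr
    exact (H.memLp_sampleNoise t k.1 k.2).2
  · exact fun k _ => (H.memLp_sampleNoise t k.1 k.2).1.const_smul (c k)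
  · intro k _ l _ hkl
    simp only [real_inner_smul_left, real_inner_smul_right]
    rw [integral_const_mul, integral_const_mul, H.integral_inner_sampleNoise t l.1 l.2
      (H.measurable_sampleNoise_other t _) (H.memLp_sampleNoise t k.1 k.2).1, mul_zero, mul_zero]
    intro h
    rw [Prod.mk.injEq] at h
    exact hkl (Sigma.ext h.1 (heq_of_eq h.2))

theorem memLp_batchNoise (H : IsDNSSRun f σ L D g P ξ W η B R x₀ run) (hB : ∀ i, B i ≠ 0)
    (t : ℕ) (i : Fin m) : MemLp (fun ω => batchNoise f run t ω i) 2 P := by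
  simp only [H.batchNoise_eq hB]
  exact memLp_finsetSum _ fun j _ => (H.memLp_sampleNoise t i j).1.const_smul ((B i : ℝ)⁻¹)

theorem integral_batchNoise_le (H : IsDNSSRun f σ L D g P ξ W η B R x₀ run) (hB : ∀ i, B i ≠ 0)
    (t : ℕ) (i : Fin m) : ∫ ω, ‖batchNoise f run t ω i‖ ^ 2 ∂P ≤ σ i ^ 2 / B i := by
  have hB' : (B i : ℝ) ≠ 0 := by exact_mod_cast hB i
  have h := H.integral_sq_norm_sum_sampleNoise_le t
    (({i} : Finset (Fin m)).sigma fun i => Finset.range (B i)) (fun k => (B k.1 : ℝ)⁻¹)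
  simp only [Finset.sum_sigma, Finset.sum_singleton] at h
  simp only [H.batchNoise_eq hB]
  refine h.trans (le_of_eq ?_)
  rw [Finset.sum_const, Finset.card_range, nsmul_eq_mul]
  field_simp

theorem integral_nodeAvg_batchNoise_le (H : IsDNSSRun f σ L D g P ξ W η B R x₀ run)
    (hB : ∀ i, B i ≠ 0) (t : ℕ) :
    ∫ ω, ‖nodeAvg (batchNoise f run t ω)‖ ^ 2 ∂P ≤ ((m : ℝ) ^ 2)⁻¹ * ∑ i, σ i ^ 2 / B i := by
  simp only [H.nodeAvg_batchNoise_eq hB]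
  refine (H.integral_sq_norm_sum_sampleNoise_le t _ _).trans (le_of_eq ?_)
  rw [Finset.sum_sigma, Finset.mul_sum]
  refine Finset.sum_congr rfl fun i _ => ?_
  have hB' : (B i : ℝ) ≠ 0 := by exact_mod_cast hB i
  simp only
  rw [Finset.sum_const, Finset.card_range, nsmul_eq_mul]
  field_simp

theorem integral_inner_nodeAvg_batchNoise (H : IsDNSSRun f σ L D g P ξ W η B R x₀ run)
    (hB : ∀ i, B i ≠ 0) (t : ℕ) {Z : Ω → EuclideanSpace ℝ (Fin d)}
    (hZ : ∀ i j, Measurable[otherSamples ξ (t, i, j)] Z) (hZL : MemLp Z 2 P) :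
    ∫ ω, inner ℝ (Z ω) (nodeAvg (batchNoise f run t ω)) ∂P = 0 := by
  simp only [H.nodeAvg_batchNoise_eq hB, inner_sum, real_inner_smul_right]
  rw [integral_finsetSum _ fun k _ => (integrable_inner_of_memLp hZL
    (H.memLp_sampleNoise t k.1 k.2).1).const_mul _]
  refine Finset.sum_eq_zero fun k _ => ?_
  rw [integral_const_mul, H.integral_inner_sampleNoise t k.1 k.2 (hZ k.1 k.2) hZL, mul_zero]

theorem memLp_run (H : IsDNSSRun f σ L D g P ξ W η B R x₀ run) (hB : ∀ i, B i ≠ 0) (t : ℕ) :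
    (∀ i, MemLp (fun ω => (run ω t).x i) 2 P) ∧ (∀ i, MemLp (fun ω => (run ω t).s i) 2 P) ∧
      ∀ i, MemLp (fun ω => (run ω t).y i) 2 P := by
  induction t with
  | zero =>
    simp only [H.run_zero]
    exact ⟨fun _ => memLp_const _, fun _ => memLp_const _, fun _ => memLp_const _⟩
  | succ t ih =>
    obtain ⟨hx, hs, hy⟩ := ih
    have hy' : ∀ i, MemLp (fun ω => (run ω (t + 1)).y i) 2 P := by
      intro i
      have h := (H.memLp_batchNoise hB t i).add ((H.smooth i).memLp_gradient (hx i))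
      refine (memLp_congr_ae (ae_of_all _ fun ω => ?_)).1 h
      simp [batchNoise]
    have hs' : ∀ i, MemLp (fun ω => (run ω (t + 1)).s i) 2 P := by
      have h := (memLp_fastMix W (φ := fun ω i => (run ω t).s i + (run ω (t + 1)).y i
        - (run ω t).y i) (fun i => ((hs i).add (hy' i)).sub (hy i)) (R t)).1
      intro i
      refine (memLp_congr_ae (ae_of_all _ fun ω => ?_)).1 (h i)
      simp only [H.run_succ, dnssStep_s]
    refine ⟨?_, hs', hy'⟩
    have h := (memLp_fastMix W (φ := fun ω i => (run ω t).x i - η • (run ω (t + 1)).s i)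
        (fun i => (hx i).sub ((hs' i).const_smul η)) (R t)).1
    intro i
    refine (memLp_congr_ae (ae_of_all _ fun ω => ?_)).1 (h i)
    simp only [H.run_succ, dnssStep_x]

end IsDNSSRun

/-! ### Expected consensus error and stationarity along a run -/

theorem integrable_devSq {m d : ℕ} {Ω : Type*} [MeasurableSpace Ω] {P : Measure Ω}
    {z : Ω → Fin m → EuclideanSpace ℝ (Fin d)} (hz : ∀ i, MemLp (fun ω => z ω i) 2 P) :
    Integrable (fun ω => devSq (z ω)) P :=
  integrable_finsetSum _ fun i _ => integrable_sq_norm ((hz i).sub (memLp_nodeAvg hz))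

theorem sum_sq_norm_sub_le {m : ℕ} {E : Type*} [NormedAddCommGroup E] [InnerProductSpace ℝ E]
    (hm : m ≠ 0) (a b : Fin m → E) :
    ∑ i, ‖a i - b i‖ ^ 2 ≤ 2 * devSq a + 2 * devSq b + m * ‖nodeAvg a - nodeAvg b‖ ^ 2 := by
  rw [← devSq_add_card_mul hm (fun i => a i - b i), nodeAvg_sub]
  have := devSq_add_smul_le (-1) a b
  simp only [neg_smul, one_smul, ← sub_eq_add_neg] at this
  linarith

namespace IsDNSSRun

variable {m d : ℕ} {Ξ : Fin m → Type*} [∀ i, MeasurableSpace (Ξ i)]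
    {Ω : Type*} [mΩ : MeasurableSpace Ω]
    {f : Fin m → EuclideanSpace ℝ (Fin d) → ℝ} {σ : Fin m → ℝ} {L : ℝ} {D : ∀ i, Measure (Ξ i)}
    {g : ∀ i, EuclideanSpace ℝ (Fin d) → Ξ i → EuclideanSpace ℝ (Fin d)}
    {P : Measure Ω} {ξ : ℕ → ∀ i : Fin m, ℕ → Ω → Ξ i}
    {G : SimpleGraph (Fin m)} {W : Matrix (Fin m) (Fin m) ℝ} {η : ℝ} {B : Fin m → ℕ} {R : ℕ → ℕ}
    {x₀ : EuclideanSpace ℝ (Fin d)} {run : Ω → ℕ → DNSSState m d}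

theorem nodeAvg_s (H : IsDNSSRun f σ L D g P ξ W η B R x₀ run) (hW : IsCommunicationMatrix G W)
    (ω : Ω) (t : ℕ) : nodeAvg (run ω t).s = nodeAvg (run ω t).y := by
  induction t with
  | zero => rw [H.run_zero]
  | succ t ih => rw [H.run_succ]; exact nodeAvg_dnssStep_s hW ih

theorem nodeAvg_x_succ (H : IsDNSSRun f σ L D g P ξ W η B R x₀ run)
    (hW : IsCommunicationMatrix G W) (ω : Ω) (t : ℕ) :
    nodeAvg (run ω (t + 1)).x = nodeAvg (run ω t).x -
      η • (nodeAvg (fun i => gradient (f i) ((run ω t).x i)) + nodeAvg (batchNoise f run t ω)) := by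
  have h : nodeAvg (run ω (t + 1)).y =
      nodeAvg (fun i => gradient (f i) ((run ω t).x i)) + nodeAvg (batchNoise f run t ω) := by
    rw [← nodeAvg_add]; simp [batchNoise]
  rw [← h, ← H.nodeAvg_s hW, H.run_succ, nodeAvg_dnssStep_x hW]

/-- The change of the mini-batch gradients between two iterations. -/
theorem sum_sq_norm_y_sub_le (H : IsDNSSRun f σ L D g P ξ W η B R x₀ run) (hm : m ≠ 0)
    (hW : IsCommunicationMatrix G W) (ω : Ω) (t : ℕ) :
    ∑ i, ‖(run ω (t + 2)).y i - (run ω (t + 1)).y i‖ ^ 2 ≤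
      4 * ∑ i, ‖batchNoise f run (t + 1) ω i‖ ^ 2 + 4 * ∑ i, ‖batchNoise f run t ω i‖ ^ 2 +
      2 * (m * L) ^ 2 * (2 * devSq (run ω (t + 1)).x + 2 * devSq (run ω t).x +
        m * η ^ 2 * (3 * ‖gradient (avgObjective f) (nodeAvg (run ω t).x)‖ ^ 2 +
          3 * (m * L ^ 2 * devSq (run ω t).x) + 3 * ‖nodeAvg (batchNoise f run t ω)‖ ^ 2)) := by
  have h1 : ∑ i, ‖(run ω (t + 2)).y i - (run ω (t + 1)).y i‖ ^ 2 ≤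
      4 * ∑ i, ‖batchNoise f run (t + 1) ω i‖ ^ 2 + 4 * ∑ i, ‖batchNoise f run t ω i‖ ^ 2 +
      2 * (m * L) ^ 2 * ∑ i, ‖(run ω (t + 1)).x i - (run ω t).x i‖ ^ 2 := by
    simp only [Finset.mul_sum, ← Finset.sum_add_distrib]
    refine Finset.sum_le_sum fun i _ => ?_
    have e : (run ω (t + 2)).y i - (run ω (t + 1)).y i =
        (batchNoise f run (t + 1) ω i - batchNoise f run t ω i) +
        (gradient (f i) ((run ω (t + 1)).x i) - gradient (f i) ((run ω t).x i)) := by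
      simp only [batchNoise]; abel
    have h2 := norm_add_sq_le (batchNoise f run (t + 1) ω i - batchNoise f run t ω i)
      (gradient (f i) ((run ω (t + 1)).x i) - gradient (f i) ((run ω t).x i))
    have h3 := norm_add_sq_le (batchNoise f run (t + 1) ω i) (-batchNoise f run t ω i)
    rw [norm_neg, ← sub_eq_add_neg] at h3
    have h4 := (H.smooth i).lipschitz ((run ω (t + 1)).x i) ((run ω t).x i)
    rw [e]
    linarith
  have h5 := sum_sq_norm_sub_le hm (run ω (t + 1)).x (run ω t).x
  -- The averaged step splits into the true gradient at the average, the bias of the local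
  -- gradients, and the mean noise.
  have h6 : ‖nodeAvg (run ω (t + 1)).x - nodeAvg (run ω t).x‖ ^ 2 ≤
      η ^ 2 * (3 * ‖gradient (avgObjective f) (nodeAvg (run ω t).x)‖ ^ 2 +
          3 * (m * L ^ 2 * devSq (run ω t).x) + 3 * ‖nodeAvg (batchNoise f run t ω)‖ ^ 2) := by
    rw [H.nodeAvg_x_succ hW, sub_sub_cancel_left, norm_neg, norm_smul, mul_pow, Real.norm_eq_abs,
      sq_abs]
    gcongr
    have h7 := norm_add_three_sq_le (gradient (avgObjective f) (nodeAvg (run ω t).x))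
      (nodeAvg (fun i => gradient (f i) ((run ω t).x i)) -
        gradient (avgObjective f) (nodeAvg (run ω t).x)) (nodeAvg (batchNoise f run t ω))
    rw [add_sub_cancel, norm_sub_rev (nodeAvg _)] at h7
    have h8 := sq_norm_gradient_bias_le hm H.smooth (run ω t).x
    linarith
  refine h1.trans ?_
  gcongr
  refine h5.trans ?_
  rw [mul_assoc (m : ℝ)]
  gcongr

/-- The descent inequality for the averaged iterates with step size `1 / (2 L)`. -/
theorem sq_norm_gradient_le (H : IsDNSSRun f σ L D g P ξ W (1 / (2 * L)) B R x₀ run) (hm : m ≠ 0)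
    (hL : 0 < L) (hf : SmoothWith L (avgObjective f))
    (hW : IsCommunicationMatrix G W) (ω : Ω) (t : ℕ) :
    ‖gradient (avgObjective f) (nodeAvg (run ω t).x)‖ ^ 2 ≤
      4 * L * (avgObjective f (nodeAvg (run ω t).x) - avgObjective f (nodeAvg (run ω (t + 1)).x)) +
      (m * L ^ 2 * devSq (run ω t).x + ‖nodeAvg (batchNoise f run t ω)‖ ^ 2 / 2 +
        inner ℝ (nodeAvg (fun i => gradient (f i) ((run ω t).x i)) -
          (2 : ℝ) • gradient (avgObjective f) (nodeAvg (run ω t).x))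
          (nodeAvg (batchNoise f run t ω))) := by
  have h1 := sq_norm_gradient_bias_le hm H.smooth (run ω t).x
  have hx := H.nodeAvg_x_succ hW ω t
  set F := gradient (avgObjective f) (nodeAvg (run ω t).x)
  set h := nodeAvg (fun i => gradient (f i) ((run ω t).x i))
  set e := nodeAvg (batchNoise f run t ω)
  have h2 := hf.descent hL.le (nodeAvg (run ω t).x) (-((1 / (2 * L)) • (h + e)))
  rw [← sub_eq_add_neg, ← hx, inner_neg_right, real_inner_smul_right, norm_neg, norm_smul,
    mul_pow, Real.norm_eq_abs, sq_abs, norm_add_sq_real, inner_add_right] at h2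
  rw [norm_sub_sq_real] at h1
  rw [inner_sub_left, real_inner_smul_left]
  -- After scaling by `4L`, polarization gives `-2⟨F, h⟩ = ‖F - h‖² - ‖F‖² - ‖h‖²`, and the last
  -- term absorbs the `‖h‖²/2` of the quadratic part.
  have h3 : 4 * L * (L / 2 * ((1 / (2 * L)) ^ 2 * (‖h‖ ^ 2 + 2 * inner ℝ h e + ‖e‖ ^ 2))) =
      (‖h‖ ^ 2 + 2 * inner ℝ h e + ‖e‖ ^ 2) / 2 := by field_simp; ring
  have h4 : 4 * L * (1 / (2 * L) * (inner ℝ F h + inner ℝ F e)) =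
      2 * (inner ℝ F h + inner ℝ F e) := by field_simp; ring
  have h5 := mul_le_mul_of_nonneg_left h2 (by positivity : 0 ≤ 4 * L)
  nlinarith [sq_nonneg ‖h‖]

/-- Telescoping for each `ω` before taking expectations removes the random function values, so their
integrability is never needed. -/
theorem sum_sq_norm_gradient_le (H : IsDNSSRun f σ L D g P ξ W (1 / (2 * L)) B R x₀ run)
    (hm : m ≠ 0) (hL : 0 < L) (hf : SmoothWith L (avgObjective f))
    (hbdd : BddBelow (Set.range (avgObjective f)))
    (hW : IsCommunicationMatrix G W) (ω : Ω) (n : ℕ) :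
    ∑ t ∈ Finset.range n, ‖gradient (avgObjective f) (nodeAvg (run ω t).x)‖ ^ 2 ≤
      4 * L * initialGap (avgObjective f) x₀ + ∑ t ∈ Finset.range n,
      (m * L ^ 2 * devSq (run ω t).x + ‖nodeAvg (batchNoise f run t ω)‖ ^ 2 / 2 +
        inner ℝ (nodeAvg (fun i => gradient (f i) ((run ω t).x i)) -
          (2 : ℝ) • gradient (avgObjective f) (nodeAvg (run ω t).x))
          (nodeAvg (batchNoise f run t ω))) := by
  have h1 := Finset.sum_le_sum fun t (_ : t ∈ Finset.range n) =>
    H.sq_norm_gradient_le hm hL hf hW ω t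
  rw [Finset.sum_add_distrib, ← Finset.mul_sum,
    Finset.sum_range_sub' (fun t => avgObjective f (nodeAvg (run ω t).x))] at h1
  have h0 : nodeAvg (run ω 0).x = x₀ := by rw [H.run_zero]; exact nodeAvg_const hm x₀
  rw [h0] at h1
  refine h1.trans ?_
  gcongr
  rw [initialGap]
  gcongr
  exact ciInf_le hbdd _

variable [IsProbabilityMeasure P] [∀ i, IsProbabilityMeasure (D i)]

theorem integral_devSq_x_succ_le (H : IsDNSSRun f σ L D g P ξ W η B R x₀ run)
    (hB : ∀ i, B i ≠ 0) (hm : 2 ≤ m) (hW : IsCommunicationMatrix G W) {β : ℝ} {t : ℕ}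
    (hβ : (3 * Real.exp (-(R t * √(spectralGap W) / 2))) ^ 2 ≤ β) :
    ∫ ω, devSq (run ω (t + 1)).x ∂P ≤
      2 * β * (∫ ω, devSq (run ω t).x ∂P + η ^ 2 * ∫ ω, devSq (run ω (t + 1)).s ∂P) := by
  have hx := integrable_devSq (H.memLp_run hB t).1
  have hx' := integrable_devSq (H.memLp_run hB (t + 1)).1
  have hs' := integrable_devSq (H.memLp_run hB (t + 1)).2.1
  rw [← integral_const_mul, ← integral_add hx (hs'.const_mul _), ← integral_const_mul]
  refine integral_mono hx' ((hx.add (hs'.const_mul _)).const_mul _) fun ω => ?_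
  have h := devSq_dnssStep_x_le (g := g) (η := η) (B := B) (R := R t)
    (ξ := fun i j => ξ t i j ω) (q := run ω t) hm hW
  rw [← H.run_succ] at h
  refine h.trans ?_
  have h1 := devSq_nonneg (run ω t).x
  have h2 := devSq_nonneg (run ω (t + 1)).s
  calc _ ≤ β * (2 * (devSq (run ω t).x + η ^ 2 * devSq (run ω (t + 1)).s)) := by gcongr
    _ = _ := by ring

theorem integral_sum_batchNoise_le (H : IsDNSSRun f σ L D g P ξ W η B R x₀ run)
    (hB : ∀ i, B i ≠ 0) (t : ℕ) :
    ∫ ω, ∑ i, ‖batchNoise f run t ω i‖ ^ 2 ∂P ≤ ∑ i, σ i ^ 2 / B i := by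
  rw [integral_finsetSum _ fun i _ => integrable_sq_norm (H.memLp_batchNoise hB t i)]
  exact Finset.sum_le_sum fun i _ => H.integral_batchNoise_le hB t i

/-- The contraction factor is kept exact, unlike the generic `β` of the other steps, because it must
still be multiplied against the initial gradients. -/
theorem integral_devSq_s_one_le (H : IsDNSSRun f σ L D g P ξ W η B R x₀ run)
    (hB : ∀ i, B i ≠ 0) (hm : 2 ≤ m) (hW : IsCommunicationMatrix G W) :
    ∫ ω, devSq (run ω 1).s ∂P ≤ (3 * Real.exp (-(R 0 * √(spectralGap W) / 2))) ^ 2 *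
      (2 * ∑ i, σ i ^ 2 / B i + 2 * ∑ i, ‖gradient (f i) x₀‖ ^ 2) := by
  have hs' := integrable_devSq (H.memLp_run hB 1).2.1
  have hn : Integrable (fun ω => ∑ i, ‖batchNoise f run 0 ω i‖ ^ 2) P :=
    integrable_finsetSum _ fun i _ => integrable_sq_norm (H.memLp_batchNoise hB 0 i)
  calc _ ≤ ∫ ω, (3 * Real.exp (-(R 0 * √(spectralGap W) / 2))) ^ 2 *
        (2 * ∑ i, ‖batchNoise f run 0 ω i‖ ^ 2 + 2 * ∑ i, ‖gradient (f i) x₀‖ ^ 2) ∂P := by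
        refine integral_mono hs' (((hn.const_mul 2).add (integrable_const _)).const_mul _)
          fun ω => ?_
        have h := devSq_dnssStep_s_le_of_zero (g := g) (η := η) (B := B) (R := R 0)
          (ξ := fun i j => ξ 0 i j ω) (q := run ω 0) hm hW (by rw [H.run_zero]; rfl)
          (by rw [H.run_zero]; rfl)
        rw [← H.run_succ] at h
        refine h.trans ?_
        gcongr
        rw [Finset.mul_sum, Finset.mul_sum, ← Finset.sum_add_distrib]
        refine Finset.sum_le_sum fun i _ => ?_
        have h2 := norm_add_sq_le (batchNoise f run 0 ω i) (gradient (f i) x₀)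
        have e : batchNoise f run 0 ω i + gradient (f i) x₀ = (run ω (0 + 1)).y i := by
          simp [batchNoise, H.run_zero]
        rwa [e] at h2
    _ ≤ _ := by
        rw [integral_const_mul, integral_add (hn.const_mul 2) (integrable_const _),
          integral_const_mul, integral_const, probReal_univ, one_smul]
        gcongr
        exact H.integral_sum_batchNoise_le hB 0

theorem memLp_gradient_avg (H : IsDNSSRun f σ L D g P ξ W η B R x₀ run)
    (hf : SmoothWith L (avgObjective f)) (hB : ∀ i, B i ≠ 0) (t : ℕ) :
    MemLp (fun ω => gradient (avgObjective f) (nodeAvg (run ω t).x)) 2 P :=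
  hf.memLp_gradient (memLp_nodeAvg (H.memLp_run hB t).1)

/-- State `t + 2` holds `sᵗ⁺¹`, produced by the rounds `R (t + 1)`, while `x` in state `t` is `xᵗ`.
The constant `8` is `4 + 4`, from the noises of two consecutive iterations. -/
theorem integral_devSq_s_add_two_le (H : IsDNSSRun f σ L D g P ξ W η B R x₀ run)
    (hf : SmoothWith L (avgObjective f))
    (hB : ∀ i, B i ≠ 0) (hm : 2 ≤ m) (hW : IsCommunicationMatrix G W) {β : ℝ} {t : ℕ}
    (hβ : (3 * Real.exp (-(R (t + 1) * √(spectralGap W) / 2))) ^ 2 ≤ β) :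
    ∫ ω, devSq (run ω (t + 2)).s ∂P ≤ 2 * β * (∫ ω, devSq (run ω (t + 1)).s ∂P +
      (8 * ∑ i, σ i ^ 2 / B i +
      2 * (m * L) ^ 2 * (2 * ∫ ω, devSq (run ω (t + 1)).x ∂P + 2 * ∫ ω, devSq (run ω t).x ∂P +
        m * η ^ 2 * (3 * ∫ ω, ‖gradient (avgObjective f) (nodeAvg (run ω t).x)‖ ^ 2 ∂P +
          3 * (m * L ^ 2 * ∫ ω, devSq (run ω t).x ∂P) +
          3 * (((m : ℝ) ^ 2)⁻¹ * ∑ i, σ i ^ 2 / B i))))) := by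
  have hx := integrable_devSq (H.memLp_run hB t).1
  have hx' := integrable_devSq (H.memLp_run hB (t + 1)).1
  have hs' := integrable_devSq (H.memLp_run hB (t + 1)).2.1
  have hs'' := integrable_devSq (H.memLp_run hB (t + 2)).2.1
  have hn : ∀ t, Integrable (fun ω => ∑ i, ‖batchNoise f run t ω i‖ ^ 2) P := fun t =>
    integrable_finsetSum _ fun i _ => integrable_sq_norm (H.memLp_batchNoise hB t i)
  have ha := integrable_sq_norm (memLp_nodeAvg (H.memLp_batchNoise hB t))
  have hF := integrable_sq_norm (H.memLp_gradient_avg hf hB t)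
  have hβ0 : 0 ≤ β := le_trans (by positivity) hβ
  have i1 := ((hF.const_mul 3).add ((hx.const_mul (m * L ^ 2)).const_mul 3)).add (ha.const_mul 3)
  have i2 := ((hx'.const_mul 2).add (hx.const_mul 2)).add (i1.const_mul (m * η ^ 2))
  have i3 := (((hn (t + 1)).const_mul 4).add ((hn t).const_mul 4)).add
    (i2.const_mul (2 * (m * L) ^ 2))
  have i4 := (hs'.add i3).const_mul (2 * β)
  refine (integral_mono hs'' i4 fun ω => ?_).trans ?_
  · have h := devSq_dnssStep_s_le (g := g) (η := η) (B := B) (R := R (t + 1))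
      (ξ := fun i j => ξ (t + 1) i j ω) (q := run ω (t + 1)) hm hW
    rw [← H.run_succ] at h
    refine h.trans ?_
    have h1 := devSq_nonneg (run ω (t + 1)).s
    have h2 : 0 ≤ ∑ i, ‖(run ω (t + 2)).y i - (run ω (t + 1)).y i‖ ^ 2 := by positivity
    calc _ ≤ β * (2 * (devSq (run ω (t + 1)).s +
          ∑ i, ‖(run ω (t + 2)).y i - (run ω (t + 1)).y i‖ ^ 2)) := by gcongr
      _ = 2 * β * (devSq (run ω (t + 1)).s +
          ∑ i, ‖(run ω (t + 2)).y i - (run ω (t + 1)).y i‖ ^ 2) := by ring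
      _ ≤ _ := by
        simp only [Pi.add_apply]
        gcongr
        exact H.sum_sq_norm_y_sub_le (by omega) hW ω t
  · rw [integral_const_mul, integral_add' hs' i3,
      integral_add' (((hn (t + 1)).const_mul 4).add ((hn t).const_mul 4))
        (i2.const_mul (2 * (m * L) ^ 2)),
      integral_add' ((hn (t + 1)).const_mul 4) ((hn t).const_mul 4), integral_const_mul,
      integral_const_mul, integral_const_mul,
      integral_add' ((hx'.const_mul 2).add (hx.const_mul 2)) (i1.const_mul (m * η ^ 2)),
      integral_add' (hx'.const_mul 2) (hx.const_mul 2), integral_const_mul, integral_const_mul,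
      integral_const_mul,
      integral_add' ((hF.const_mul 3).add ((hx.const_mul (m * L ^ 2)).const_mul 3))
        (ha.const_mul 3),
      integral_add' (hF.const_mul 3) ((hx.const_mul (m * L ^ 2)).const_mul 3), integral_const_mul,
      integral_const_mul, integral_const_mul, integral_const_mul]
    have h1 := H.integral_sum_batchNoise_le hB (t + 1)
    have h2 := H.integral_sum_batchNoise_le hB t
    have h3 := H.integral_nodeAvg_batchNoise_le hB t
    gcongr
    linarith

theorem sum_integral_sq_norm_gradient_le
    (H : IsDNSSRun f σ L D g P ξ W (1 / (2 * L)) B R x₀ run)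
    (hm : m ≠ 0) (hL : 0 < L) (hf : SmoothWith L (avgObjective f))
    (hbdd : BddBelow (Set.range (avgObjective f))) (hB : ∀ i, B i ≠ 0)
    (hW : IsCommunicationMatrix G W) (n : ℕ) :
    ∑ t ∈ Finset.range n, ∫ ω, ‖gradient (avgObjective f) (nodeAvg (run ω t).x)‖ ^ 2 ∂P ≤
      4 * L * initialGap (avgObjective f) x₀ + ∑ t ∈ Finset.range n,
      (m * L ^ 2 * ∫ ω, devSq (run ω t).x ∂P + ((m : ℝ) ^ 2)⁻¹ * (∑ i, σ i ^ 2 / B i) / 2) := by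
  have hx := fun t => integrable_devSq (H.memLp_run hB t).1
  have ha := fun t => integrable_sq_norm (memLp_nodeAvg (H.memLp_batchNoise hB t))
  have hF := fun t => H.memLp_gradient_avg hf hB t
  have hZ : ∀ t, MemLp (fun ω => nodeAvg (fun i => gradient (f i) ((run ω t).x i)) -
      (2 : ℝ) • gradient (avgObjective f) (nodeAvg (run ω t).x)) 2 P := fun t =>
    (memLp_nodeAvg fun i => (H.smooth i).memLp_gradient ((H.memLp_run hB t).1 i)).sub
      ((hF t).const_smul (2 : ℝ))
  have hZe := fun t => integrable_inner_of_memLp (hZ t) (memLp_nodeAvg (H.memLp_batchNoise hB t))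
  have hsum := fun t => (((hx t).const_mul (m * L ^ 2)).add ((ha t).div_const 2)).add (hZe t)
  rw [← integral_finsetSum _ fun t _ => integrable_sq_norm (hF t)]
  refine (integral_mono (integrable_finsetSum _ fun t _ => integrable_sq_norm (hF t))
    ((integrable_const (4 * L * initialGap (avgObjective f) x₀)).add
      (integrable_finsetSum (Finset.range n) fun t _ => hsum t))
    fun ω => H.sum_sq_norm_gradient_le hm hL hf hbdd hW ω n).trans ?_
  rw [integral_add' (integrable_const _) (integrable_finsetSum (Finset.range n) fun t _ => hsum t),
    integral_const, probReal_univ, one_smul, integral_finsetSum _ fun t _ => hsum t]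
  gcongr with t
  -- The vector paired with the noise depends on `xᵗ` alone, hence only on earlier samples, so the
  -- cross term has mean zero.
  have hmeas : ∀ i j, Measurable[otherSamples ξ (t, i, j)] fun ω =>
      nodeAvg (fun i => gradient (f i) ((run ω t).x i)) -
      (2 : ℝ) • gradient (avgObjective f) (nodeAvg (run ω t).x) := by
    intro i j
    have h1 := fun k => H.measurable_x_other t k i j
    have h2 : Measurable[otherSamples ξ (t, i, j)] fun ω => nodeAvg (run ω t).x :=
      (Finset.measurable_fun_sum Finset.univ fun k _ => h1 k).const_smul ((m : ℝ)⁻¹)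
    have h3 : Measurable[otherSamples ξ (t, i, j)] fun ω =>
        nodeAvg (fun i => gradient (f i) ((run ω t).x i)) :=
      (Finset.measurable_fun_sum Finset.univ fun k _ =>
        (H.smooth k).measurable_gradient.comp (h1 k)).const_smul ((m : ℝ)⁻¹)
    exact h3.sub ((hf.measurable_gradient.comp h2).const_smul (2 : ℝ))
  rw [integral_add' (((hx t).const_mul (m * L ^ 2)).add ((ha t).div_const 2)) (hZe t),
    integral_add' ((hx t).const_mul (m * L ^ 2)) ((ha t).div_const 2), integral_const_mul,
    integral_div, H.integral_inner_nodeAvg_batchNoise hB t hmeas (hZ t), add_zero]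
  gcongr
  exact H.integral_nodeAvg_batchNoise_le hB t

theorem integral_sq_norm_gradient_node_le (H : IsDNSSRun f σ L D g P ξ W η B R x₀ run)
    (hf : SmoothWith L (avgObjective f)) (hB : ∀ i, B i ≠ 0) (t : ℕ) (i : Fin m) :
    ∫ ω, ‖gradient (avgObjective f) ((run ω t).x i)‖ ^ 2 ∂P ≤
      2 * ∫ ω, ‖gradient (avgObjective f) (nodeAvg (run ω t).x)‖ ^ 2 ∂P +
      2 * (L ^ 2 * ∫ ω, devSq (run ω t).x ∂P) := by
  have hx := integrable_devSq (H.memLp_run hB t).1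
  have hF := integrable_sq_norm (H.memLp_gradient_avg hf hB t)
  rw [← integral_const_mul, ← integral_const_mul, ← integral_const_mul,
    ← integral_add (hF.const_mul _) ((hx.const_mul _).const_mul _)]
  refine integral_mono (integrable_sq_norm (hf.memLp_gradient ((H.memLp_run hB t).1 i)))
    ((hF.const_mul _).add ((hx.const_mul _).const_mul _)) fun ω => ?_
  have h1 := norm_add_sq_le (gradient (avgObjective f) (nodeAvg (run ω t).x))
    (gradient (avgObjective f) ((run ω t).x i) - gradient (avgObjective f) (nodeAvg (run ω t).x))
  rw [add_sub_cancel] at h1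
  have h2 := hf.lipschitz ((run ω t).x i) (nodeAvg (run ω t).x)
  have h3 := mul_le_mul_of_nonneg_left (sq_norm_sub_nodeAvg_le (run ω t).x i) (sq_nonneg L)
  simp only
  linarith

end IsDNSSRun

/-! ### Solving the recursion -/

/-- Summation shifts the index by one: the initial bound supplies the missing `e`, and the
nonnegative last terms complete the sums. The sum of `Φ` stays on the right, to be absorbed when `κ`
is small. -/
theorem sum_le_of_coupled_recursion {Φ N : ℕ → ℝ} {κ e : ℝ} (hκ : 0 ≤ κ)
    (hΦ : ∀ t, 0 ≤ Φ t) (hN : ∀ t, 0 ≤ N t) (h0 : Φ 0 ≤ κ * e)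
    (h1 : ∀ t, Φ (t + 1) ≤ κ * (Φ t + N t + e)) (n : ℕ) :
    ∑ t ∈ Finset.range n, Φ t ≤
      κ * (∑ t ∈ Finset.range n, Φ t + ∑ t ∈ Finset.range n, N t + n * e) := by
  have h : ∀ n : ℕ, ∑ t ∈ Finset.range (n + 1), Φ t ≤
      κ * (∑ t ∈ Finset.range n, Φ t + ∑ t ∈ Finset.range n, N t + (n + 1) * e) := by
    intro n
    induction n with
    | zero => simpa using h0
    | succ n ih =>
      rw [Finset.sum_range_succ]
      have := h1 n
      calc _ ≤ _ := add_le_add ih this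
        _ = _ := by
          rw [Finset.sum_range_succ Φ n, Finset.sum_range_succ N n]; push_cast; ring
  rcases n with _ | n
  · simp
  · refine (h n).trans ?_
    rw [Finset.sum_range_succ Φ n, Finset.sum_range_succ N n]
    push_cast
    have h2 := hΦ n
    have h3 := hN n
    gcongr κ * ?_
    linarith

/-- One step of the recursion for the consensus error `p` of the iterates and the tracking
error `s`. -/
theorem consensus_step_le {M β e p p' s s' N : ℝ} (hM : 2 ≤ M) (hβ : 0 ≤ β)
    (hβM : 2000 * (β * M ^ 5) ≤ 1) (he : 0 ≤ e) (hp : 0 ≤ p) (hp' : 0 ≤ p') (hs : 0 ≤ s)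
    (hN : 0 ≤ N) (h1 : p' ≤ 2 * β * (p + s / 4))
    (h2 : s' ≤ 2 * β * (s + (8 * (M ^ 2 * (e / 16)) + 2 * M ^ 2 * (2 * p' + 2 * p +
      M / 4 * (3 * N + 3 * (M * p) + 3 * (e / 16)))))) :
    p' + s' ≤ 20 * β * M ^ 4 * (p + s + N + e) := by
  have m2 : 4 ≤ M ^ 2 := by nlinarith
  have m3 : 2 * M ^ 2 ≤ M ^ 3 := by nlinarith [sq_nonneg M]
  have m4 : 2 * M ^ 3 ≤ M ^ 4 := by nlinarith [sq_nonneg M]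
  have m5 : 2 * M ^ 4 ≤ M ^ 5 := by nlinarith [sq_nonneg M]
  -- The worst power: `M²` from the squared local constant, `M` from the average step counted at `m`
  -- nodes, `M` from the bias. Lower powers are reduced to `K` by `M ≥ 2`.
  set K := β * M ^ 4 with hK
  have k0 : 16 * β ≤ K := by nlinarith
  have k2 : 4 * (β * M ^ 2) ≤ K := by nlinarith
  have k3 : 2 * (β * M ^ 3) ≤ K := by nlinarith
  have k5 : 4000 * K ≤ 1 := by nlinarith
  have hK0 : 0 ≤ K := by positivity
  have a1 : 2 * β * (p + s / 4) ≤ K / 8 * (p + s) := by nlinarith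
  -- The new error `p'` also occurs on the right of `h2`; its coefficient is below one, so it costs
  -- just one more copy of `h1`.
  have a2 : 8 * (β * M ^ 2) * p' ≤ p' := by nlinarith
  have a3 : 2 * β * s ≤ K / 8 * s := by nlinarith
  have a4 : 8 * (β * M ^ 2) * p ≤ 2 * K * p := by nlinarith
  have a5 : 3 * (β * M ^ 3) * N ≤ 3 / 2 * K * N := by nlinarith
  have a6 : (β * M ^ 2) * e ≤ K / 4 * e := by nlinarith
  have a7 : 3 / 16 * (β * M ^ 3) * e ≤ 3 / 32 * K * e := by nlinarith
  have e2 : 2 * β * (s + (8 * (M ^ 2 * (e / 16)) + 2 * M ^ 2 * (2 * p' + 2 * p +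
      M / 4 * (3 * N + 3 * (M * p) + 3 * (e / 16))))) = 2 * β * s + (β * M ^ 2) * e +
      8 * (β * M ^ 2) * p' + 8 * (β * M ^ 2) * p + 3 * (β * M ^ 3) * N + 3 * K * p +
      3 / 16 * (β * M ^ 3) * e := by rw [hK]; ring
  rw [e2] at h2
  have e3 : 20 * β * M ^ 4 * (p + s + N + e) =
      20 * (K * p) + 20 * (K * s) + 20 * (K * N) + 20 * (K * e) := by rw [hK]; ring
  rw [e3]
  have b1 := mul_nonneg hK0 hp
  have b2 := mul_nonneg hK0 hs
  have b3 := mul_nonneg hK0 hN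
  have b4 := mul_nonneg hK0 he
  linarith

/-- A small-gain argument: gradients feed the consensus error with gain `κ`, which feeds back into
the gradients with weight `M`. The hypothesis with `2000` says exactly `100 M κ ≤ 1`, so only the
contributions of `δ` and `e` survive. -/
theorem sum_stationarity_le {M β e δ : ℝ} {p s N : ℕ → ℝ} {n : ℕ} (hM : 2 ≤ M) (hβ : 0 ≤ β)
    (hβM : 2000 * (β * M ^ 5) ≤ 1) (he : 0 ≤ e) (hp : ∀ t, 0 ≤ p t) (hs : ∀ t, 0 ≤ s t)
    (hN : ∀ t, 0 ≤ N t) (hp0 : p 0 = 0) (hs1 : s 1 ≤ β * (M ^ 2 / 8 + 2 * M) * e)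
    (h1 : ∀ t, p (t + 1) ≤ 2 * β * (p t + s (t + 1) / 4))
    (h2 : ∀ t, s (t + 2) ≤ 2 * β * (s (t + 1) + (8 * (M ^ 2 * (e / 16)) + 2 * M ^ 2 *
      (2 * p (t + 1) + 2 * p t + M / 4 * (3 * N t + 3 * (M * p t) + 3 * (e / 16))))))
    (h3 : ∑ t ∈ Finset.range n, N t ≤ δ + ∑ t ∈ Finset.range n, (M * p t + e / 32))
    (hδ : 8 * δ ≤ n * e) :
    ∑ t ∈ Finset.range n, (2 * N t + 2 * p t) ≤ n * e := by
  set κ := 20 * β * M ^ 4 with hκ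
  have hκ0 : 0 ≤ κ := by positivity
  have hκM : 100 * M * κ ≤ 1 := by rw [hκ]; nlinarith
  have hrec := sum_le_of_coupled_recursion (Φ := fun t => p t + s (t + 1)) (N := N) hκ0
    (fun t => add_nonneg (hp t) (hs (t + 1))) hN
    (by
      simp only [hp0, zero_add]
      refine hs1.trans ?_
      have m3 : M ^ 2 / 8 + 2 * M ≤ 20 * M ^ 4 := by
        nlinarith [sq_nonneg M, sq_nonneg (M ^ 2 - 4), mul_self_nonneg (M - 2)]
      calc _ ≤ β * (20 * M ^ 4) * e := by gcongr
        _ = _ := by rw [hκ]; ring)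
    (fun t => consensus_step_le hM hβ hβM he (hp t) (hp (t + 1)) (hs (t + 1)) (hN t) (h1 t) (h2 t))
    n
  have hple : ∑ t ∈ Finset.range n, p t ≤ ∑ t ∈ Finset.range n, (p t + s (t + 1)) :=
    Finset.sum_le_sum fun t _ => le_add_of_nonneg_right (hs (t + 1))
  simp only [Finset.sum_add_distrib, ← Finset.mul_sum, Finset.sum_const, Finset.card_range,
    nsmul_eq_mul] at h3 hrec hple ⊢
  rw [← Finset.sum_add_distrib] at hrec hple
  set A := ∑ t ∈ Finset.range n, (p t + s (t + 1))
  set Q := ∑ t ∈ Finset.range n, N t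
  set p₁ := ∑ t ∈ Finset.range n, p t
  have hA : 0 ≤ A := Finset.sum_nonneg fun t _ => add_nonneg (hp t) (hs (t + 1))
  have hQ : 0 ≤ Q := Finset.sum_nonneg fun t _ => hN t
  have hne : 0 ≤ n * e := by positivity
  have h4 : 100 * (M * A) ≤ A + Q + n * e := by
    calc 100 * (M * A) ≤ 100 * (M * (κ * (A + Q + n * e))) := by gcongr
      _ = (100 * M * κ) * (A + Q + n * e) := by ring
      _ ≤ 1 * (A + Q + n * e) := by gcongr
      _ = _ := one_mul _
  have h5 : 2 * A ≤ M * A := by gcongr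
  have h6 : M * p₁ ≤ M * A := by gcongr
  linarith

/-! ### The parameters -/

theorem sq_contraction_le {χ Λ : ℝ} (hχ : 0 < χ) (hΛ : 0 < Λ) {R : ℕ}
    (hR : 20 / √χ * Real.log Λ ≤ R) :
    (3 * Real.exp (-(R * √χ / 2))) ^ 2 ≤ 9 * (Λ ^ 20)⁻¹ := by
  have hs : 0 < √χ := Real.sqrt_pos.2 hχ
  have h1 : 20 * Real.log Λ ≤ R * √χ := by
    calc 20 * Real.log Λ = 20 / √χ * Real.log Λ * √χ := by field_simp
      _ ≤ _ := by gcongr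
  have h2 : Real.exp (-(R * √χ / 2)) ^ 2 ≤ (Λ ^ 20)⁻¹ := by
    rw [← Real.exp_nat_mul]
    calc _ ≤ Real.exp (-(20 * Real.log Λ)) := by
          gcongr; push_cast; linarith
      _ = _ := by
          rw [Real.exp_neg, ← Real.exp_log hΛ, ← Real.exp_nat_mul, Real.log_exp]; norm_num
  rw [mul_pow]; linarith

theorem batchSize_ne_zero {m : ℕ} {σ : Fin m → ℝ} (hσ : ∀ i, 0 < σ i) {ε : ℝ} (hε : 0 < ε)
    (i : Fin m) : batchSize σ ε i ≠ 0 := by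
  have : 0 < ∑ j, σ j := Finset.sum_pos (fun j _ => hσ j) ⟨i, Finset.mem_univ i⟩
  have hm : (0 : ℝ) < m := by exact_mod_cast i.pos
  have hi := hσ i
  exact (Nat.ceil_pos.2 (by positivity)).ne'

/-- Batches proportional to `σᵢ` turn each `σᵢ²/Bᵢ` into a multiple of `σᵢ`, and `∑ⱼ σⱼ` cancels.
The same proportionality makes the total batch size depend on the arithmetic mean of the `σᵢ`. -/
theorem sum_sq_div_batchSize_le {m : ℕ} (hm : m ≠ 0) {σ : Fin m → ℝ} (hσ : ∀ i, 0 < σ i) {ε : ℝ}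
    (hε : 0 < ε) : ∑ i, σ i ^ 2 / batchSize σ ε i ≤ (m : ℝ) ^ 2 * (ε ^ 2 / 16) := by
  have hm' : (0 : ℝ) < m := by positivity
  have hne : Nonempty (Fin m) := ⟨⟨0, Nat.pos_of_ne_zero hm⟩⟩
  have hS : 0 < ∑ j, σ j := Finset.sum_pos (fun j _ => hσ j) Finset.univ_nonempty
  calc ∑ i, σ i ^ 2 / batchSize σ ε i
      ≤ ∑ i, σ i * ((m : ℝ) ^ 2 * ε ^ 2 / (16 * ∑ j, σ j)) := by
        refine Finset.sum_le_sum fun i _ => ?_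
        have hi := hσ i
        calc σ i ^ 2 / batchSize σ ε i
            ≤ σ i ^ 2 / (16 * σ i * (∑ j, σ j) / ((m : ℝ) ^ 2 * ε ^ 2)) := by
              gcongr; exact Nat.le_ceil _
          _ = _ := by field_simp
    _ = _ := by rw [← Finset.sum_mul]; field_simp

theorem sum_batchSize_le {m : ℕ} {σ : Fin m → ℝ} (hσ : ∀ i, 0 < σ i) {ε : ℝ} :
    ∑ i, (batchSize σ ε i : ℝ) ≤ 16 * sigmaAM σ ^ 2 / ε ^ 2 + m := by
  have hS : 0 ≤ ∑ j, σ j := Finset.sum_nonneg fun j _ => (hσ j).le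
  calc ∑ i, (batchSize σ ε i : ℝ)
      ≤ ∑ i, (16 * σ i * (∑ j, σ j) / ((m : ℝ) ^ 2 * ε ^ 2) + 1) := by
        refine Finset.sum_le_sum fun i _ => (Nat.ceil_lt_add_one ?_).le
        have := hσ i
        positivity
    _ = _ := by
        rw [Finset.sum_add_distrib, ← Finset.sum_div, ← Finset.sum_mul, ← Finset.mul_sum, sigmaAM]
        simp
        ring

/-- The hypothesis gives `1 ≤ 2ΔL/ε²`, so rounding up raises `32` to at most `34`. -/
theorem numIter_le {Δ L ε : ℝ} (hε : 0 < ε) (h : ε ^ 2 ≤ 2 * Δ * L) :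
    (numIter Δ L ε : ℝ) ≤ 34 * (Δ * L / ε ^ 2) := by
  have h2 : 1 ≤ 2 * (Δ * L / ε ^ 2) := by
    rw [← mul_div_assoc, le_div_iff₀ (by positivity)]; linarith
  have h3 : 32 * Δ * L / ε ^ 2 = 32 * (Δ * L / ε ^ 2) := by ring
  have := (Nat.ceil_lt_add_one (a := 32 * Δ * L / ε ^ 2) (by rw [h3]; linarith)).le
  rw [numIter]
  linarith

theorem dnss_counts {m d : ℕ} {Ξ : Fin m → Type*}
    (g : ∀ i, EuclideanSpace ℝ (Fin d) → Ξ i → EuclideanSpace ℝ (Fin d))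
    (W : Matrix (Fin m) (Fin m) ℝ) (η : ℝ) (B : Fin m → ℕ) (R : ℕ → ℕ)
    (x₀ : EuclideanSpace ℝ (Fin d)) (ξ : ℕ → ∀ i, ℕ → Ξ i) (t : ℕ) :
    (dnss g W η B R x₀ ξ t).gradEvals = t * ∑ i, B i ∧
      (dnss g W η B R x₀ ξ t).commRounds = ∑ s ∈ Finset.range t, 2 * R s := by
  induction t with
  | zero => simp [dnss]
  | succ t ih =>
    simp only [dnss, dnssStep, fastMix_rounds, ih.1, ih.2, Finset.sum_range_succ]
    constructor <;> ring

theorem mixRounds_le {m : ℕ} (hm : 2 ≤ m) {c χ G₀ ε : ℝ} (hc : 0 ≤ c) (hχ : 0 < χ) (hχ1 : χ ≤ 1)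
    (hG : 0 ≤ G₀) (hε : 0 < ε) (t : ℕ) :
    (mixRounds c m χ G₀ ε t : ℝ) ≤ (c + 2) / √χ * Real.log (m * (1 + G₀ / ε)) := by
  have hm' : (2 : ℝ) ≤ m := by exact_mod_cast hm
  have hG' : 0 ≤ G₀ / ε := by positivity
  have hle : (m : ℝ) ≤ m * (1 + G₀ / ε) := by nlinarith
  have hlog : Real.log m ≤ Real.log (m * (1 + G₀ / ε)) := Real.log_le_log (by linarith) hle
  have hlog2 : 1 / 2 ≤ Real.log m :=
    -- Since `m ≥ 2` and `χ ≤ 1`, the quantity `(2/√χ) log(·)` is at least `1` and pays for the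
    -- ceiling.
    (by linarith [Real.log_two_gt_d9] : 1 / 2 ≤ Real.log 2).trans
      (Real.log_le_log (by norm_num) hm')
  have hs : 0 < √χ := Real.sqrt_pos.2 hχ
  have hs1 : √χ ≤ 1 := Real.sqrt_le_one.2 hχ1
  have h1 : 1 ≤ 2 / √χ * Real.log (m * (1 + G₀ / ε)) := by
    rw [div_mul_eq_mul_div, le_div_iff₀ hs]; linarith
  have hx : 0 ≤ c / √χ * Real.log m := mul_nonneg (by positivity) (by linarith)
  have hxy : c / √χ * Real.log m ≤ c / √χ * Real.log (m * (1 + G₀ / ε)) := by gcongr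
  have hsplit : (c + 2) / √χ * Real.log (m * (1 + G₀ / ε)) =
      c / √χ * Real.log (m * (1 + G₀ / ε)) + 2 / √χ * Real.log (m * (1 + G₀ / ε)) := by ring
  rw [hsplit, mixRounds]
  split_ifs
  · linarith [(Nat.ceil_lt_add_one (hx.trans hxy)).le]
  · linarith [(Nat.ceil_lt_add_one hx).le]

/-! ### Sampling a random index -/

theorem integral_uniform_index {Ω : Type*} [MeasurableSpace Ω] {P : Measure Ω}
    [IsProbabilityMeasure P] {T : ℕ} {τ : Ω → Fin (T + 1)} (hτ : Measurable τ)
    (hlaw : P.map τ = (PMF.uniformOfFintype (Fin (T + 1))).toMeasure) {φ : ℕ → Ω → ℝ}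
    (hφ : ∀ t, Integrable (φ t) P) (hind : ∀ t, IndepFun τ (φ t) P) :
    Integrable (fun ω => φ (τ ω) ω) P ∧
      ∫ ω, φ (τ ω) ω ∂P = ((T + 1 : ℕ) : ℝ)⁻¹ * ∑ t ∈ Finset.range (T + 1), ∫ ω, φ t ω ∂P := by
  classical
  let χ : Fin (T + 1) → Fin (T + 1) → ℝ := fun k a => if a = k then 1 else 0
  have hχ : ∀ k, Measurable (χ k) := fun k => measurable_of_finite _
  have hsum : (fun ω => φ (τ ω) ω) = fun ω => ∑ k, χ k (τ ω) * φ k ω := by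
    funext ω; simp [χ]
  have hχi : ∀ k, Integrable (fun ω => χ k (τ ω)) P := fun k =>
    Integrable.of_bound ((hχ k).comp hτ).aestronglyMeasurable 1
      (ae_of_all _ fun ω => by simp only [χ]; split_ifs <;> simp)
  have hik : ∀ k : Fin (T + 1), IndepFun (fun ω => χ k (τ ω)) (φ k) P := fun k =>
    (hind k).comp (hχ k) measurable_id
  have hint : ∀ k : Fin (T + 1), Integrable (fun ω => χ k (τ ω) * φ k ω) P := fun k =>
    (hik k).integrable_mul (hχi k) (hφ k)
  have hprob : ∀ k, ∫ ω, χ k (τ ω) ∂P = ((T + 1 : ℕ) : ℝ)⁻¹ := by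
    intro k
    have h1 : ∫ ω, χ k (τ ω) ∂P = ∫ a, χ k a ∂(P.map τ) :=
      (integral_map hτ.aemeasurable (hχ k).aestronglyMeasurable).symm
    have h2 : χ k = ({k} : Set (Fin (T + 1))).indicator 1 := by
      funext a; simp [χ, Set.indicator_apply]
    rw [h1, h2, integral_indicator_one (measurableSet_singleton k), Measure.real, hlaw,
      PMF.toMeasure_apply_singleton _ _ (measurableSet_singleton k), PMF.uniformOfFintype_apply,
      ENNReal.toReal_inv, Fintype.card_fin, ENNReal.toReal_natCast]
  refine ⟨by rw [hsum]; exact integrable_finsetSum _ fun k _ => hint k, ?_⟩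
  rw [hsum, integral_finsetSum _ fun k _ => hint k, Finset.mul_sum, Finset.sum_range]
  refine Finset.sum_congr rfl fun k _ => ?_
  rw [(hik k).integral_fun_mul_eq_mul_integral (hχi k).1 (hφ k).1, hprob]

theorem IsDNSSRun.indepFun_of_indepFun_samples {m d : ℕ} {Ξ : Fin m → Type*}
    [∀ i, MeasurableSpace (Ξ i)] {Ω : Type*} [mΩ : MeasurableSpace Ω]
    {f : Fin m → EuclideanSpace ℝ (Fin d) → ℝ} {σ : Fin m → ℝ} {L : ℝ} {D : ∀ i, Measure (Ξ i)}
    {g : ∀ i, EuclideanSpace ℝ (Fin d) → Ξ i → EuclideanSpace ℝ (Fin d)}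
    {P : Measure Ω} {ξ : ℕ → ∀ i : Fin m, ℕ → Ω → Ξ i}
    {W : Matrix (Fin m) (Fin m) ℝ} {η : ℝ} {B : Fin m → ℕ} {R : ℕ → ℕ}
    {x₀ : EuclideanSpace ℝ (Fin d)} {run : Ω → ℕ → DNSSState m d}
    (H : IsDNSSRun f σ L D g P ξ W η B R x₀ run) {α : Type*} [MeasurableSpace α] {τ : Ω → α}
    (hτ : IndepFun τ (fun ω (p : ℕ × Fin m × ℕ) => ξ p.1 p.2.1 p.2.2 ω) P)
    (t : ℕ) (i : Fin m) : IndepFun τ (fun ω => (run ω t).x i) P := by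
  let Y : Ω → ∀ p : ℕ × Fin m × ℕ, Ξ p.2.1 := fun ω p => ξ p.1 p.2.1 p.2.2 ω
  have hξ : ∀ t i j, Measurable[MeasurableSpace.comap Y inferInstance] (ξ t i j) := fun t i j =>
    (measurable_pi_apply (t, i, j)).comp (comap_measurable Y)
  have hx := (H.measurable_run _ t fun s _ i j => hξ s i j).1 i
  rw [IndepFun_iff_Indep] at hτ ⊢
  exact indep_of_indep_of_le_right hτ (measurable_iff_comap_le.1 hx)

theorem sq_contraction_mixRounds_le {m : ℕ} (hm : 2 ≤ m) {χ G₀ ε : ℝ} (hχ : 0 < χ)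
    (hG : 0 ≤ G₀) (hε : 0 < ε) (t : ℕ) :
    (3 * Real.exp (-(mixRounds 20 m χ G₀ ε t * √χ / 2))) ^ 2 ≤ 9 * ((m : ℝ) ^ 20)⁻¹ := by
  have hM : (2 : ℝ) ≤ m := by exact_mod_cast hm
  have hu1 : 1 ≤ 1 + G₀ / ε := by linarith [div_nonneg hG hε.le]
  rcases t with _ | t
  · refine (sq_contraction_le hχ (by positivity : 0 < m * (1 + G₀ / ε)) (Nat.le_ceil _)).trans ?_
    gcongr
    nlinarith
  · exact sq_contraction_le hχ (by positivity) (Nat.le_ceil _)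

/-- The extra logarithm in `R₀` contributes the factor `(1 + G₀/ε)⁻²⁰`, more than enough to turn
`G₀²` into `ε²`. -/
theorem sq_contraction_mixRounds_zero_mul_le {m : ℕ} (hm : 2 ≤ m) {χ G₀ ε : ℝ} (hχ : 0 < χ)
    (hG : 0 ≤ G₀) (hε : 0 < ε) :
    (3 * Real.exp (-(mixRounds 20 m χ G₀ ε 0 * √χ / 2))) ^ 2 * G₀ ^ 2 ≤
      9 * ((m : ℝ) ^ 20)⁻¹ * ε ^ 2 := by
  have hM : (2 : ℝ) ≤ m := by exact_mod_cast hm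
  set u := 1 + G₀ / ε with hu
  have hu1 : 1 ≤ u := by rw [hu]; linarith [div_nonneg hG hε.le]
  have hR0 : (3 * Real.exp (-(mixRounds 20 m χ G₀ ε 0 * √χ / 2))) ^ 2 ≤
      9 * (((m : ℝ) * u) ^ 20)⁻¹ :=
    sq_contraction_le hχ (by positivity) (Nat.le_ceil _)
  have hGe : G₀ ^ 2 ≤ u ^ 20 * ε ^ 2 := by
    have h1 : G₀ ^ 2 = (G₀ / ε) ^ 2 * ε ^ 2 := by field_simp
    rw [h1]
    gcongr
    calc (G₀ / ε) ^ 2 ≤ u ^ 2 := by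
          gcongr
          rw [hu]; linarith
      _ ≤ u ^ 20 := pow_le_pow_right₀ hu1 (by norm_num)
  calc _ ≤ 9 * (((m : ℝ) * u) ^ 20)⁻¹ * (u ^ 20 * ε ^ 2) := by gcongr
    _ = _ := by field_simp

theorem sum_sq_norm_gradient_eq {m d : ℕ} (hm : m ≠ 0)
    (f : Fin m → EuclideanSpace ℝ (Fin d) → ℝ) (x₀ : EuclideanSpace ℝ (Fin d)) :
    ∑ i, ‖gradient (f i) x₀‖ ^ 2 = m * initialGradSize f x₀ ^ 2 := by
  rw [initialGradSize, Real.sq_sqrt (by positivity)]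
  field_simp

/-- The initial gradient tracking error is absorbed by the rounds of the first iteration. -/
theorem IsDNSSRun.integral_devSq_s_one_le_of_mixRounds {m d : ℕ} {Ξ : Fin m → Type*}
    [∀ i, MeasurableSpace (Ξ i)]
    {Ω : Type*} [mΩ : MeasurableSpace Ω]
    {f : Fin m → EuclideanSpace ℝ (Fin d) → ℝ} {σ : Fin m → ℝ} {L : ℝ} {D : ∀ i, Measure (Ξ i)}
    {g : ∀ i, EuclideanSpace ℝ (Fin d) → Ξ i → EuclideanSpace ℝ (Fin d)}
    {P : Measure Ω} [IsProbabilityMeasure P] [∀ i, IsProbabilityMeasure (D i)]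
    {ξ : ℕ → ∀ i : Fin m, ℕ → Ω → Ξ i} {G : SimpleGraph (Fin m)}
    {W : Matrix (Fin m) (Fin m) ℝ} {η : ℝ} {B : Fin m → ℕ} {R : ℕ → ℕ}
    {x₀ : EuclideanSpace ℝ (Fin d)} {run : Ω → ℕ → DNSSState m d} {ε : ℝ}
    (H : IsDNSSRun f σ L D g P ξ W η B R x₀ run) (hB : ∀ i, B i ≠ 0) (hm : 2 ≤ m)
    (hW : IsCommunicationMatrix G W) (hε : 0 < ε)
    (hv : ∑ i, σ i ^ 2 / B i ≤ (m : ℝ) ^ 2 * (ε ^ 2 / 16))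
    (hR : R = mixRounds 20 m (spectralGap W) (initialGradSize f x₀) ε) :
    ∫ ω, devSq (run ω 1).s ∂P ≤
      9 * ((m : ℝ) ^ 20)⁻¹ * ((m : ℝ) ^ 2 / 8 + 2 * m) * ε ^ 2 := by
  refine (H.integral_devSq_s_one_le hB hm hW).trans ?_
  rw [sum_sq_norm_gradient_eq (by omega), hR]
  have hχ := (hW.spectralGap_mem hm).1
  have hG0 : 0 ≤ initialGradSize f x₀ := Real.sqrt_nonneg _
  have h1 := sq_contraction_mixRounds_le hm hχ hG0 hε 0
  have h2 := sq_contraction_mixRounds_zero_mul_le hm hχ hG0 hε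
  set r := (3 * Real.exp (-(mixRounds 20 m (spectralGap W) (initialGradSize f x₀) ε 0 *
    √(spectralGap W) / 2))) ^ 2
  set G₀ := initialGradSize f x₀
  have hr : 0 ≤ r := by positivity
  calc _ ≤ r * (2 * ((m : ℝ) ^ 2 * (ε ^ 2 / 16)) + 2 * (m * G₀ ^ 2)) := by gcongr
    _ = r * ((m : ℝ) ^ 2 / 8 * ε ^ 2) + 2 * m * (r * G₀ ^ 2) := by ring
    _ ≤ 9 * ((m : ℝ) ^ 20)⁻¹ * ((m : ℝ) ^ 2 / 8 * ε ^ 2) +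
        2 * m * (9 * ((m : ℝ) ^ 20)⁻¹ * ε ^ 2) := by gcongr
    _ = _ := by ring

/-- Averaged over the iterations and in expectation, every node is stationary. -/
theorem IsDNSSRun.sum_integral_le {m d : ℕ} {Ξ : Fin m → Type*} [∀ i, MeasurableSpace (Ξ i)]
    {Ω : Type*} [mΩ : MeasurableSpace Ω]
    {f : Fin m → EuclideanSpace ℝ (Fin d) → ℝ} {σ : Fin m → ℝ} {L : ℝ} {D : ∀ i, Measure (Ξ i)}
    {g : ∀ i, EuclideanSpace ℝ (Fin d) → Ξ i → EuclideanSpace ℝ (Fin d)}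
    {P : Measure Ω} [IsProbabilityMeasure P] [∀ i, IsProbabilityMeasure (D i)]
    {ξ : ℕ → ∀ i : Fin m, ℕ → Ω → Ξ i} {G : SimpleGraph (Fin m)}
    {W : Matrix (Fin m) (Fin m) ℝ} {B : Fin m → ℕ} {R : ℕ → ℕ}
    {x₀ : EuclideanSpace ℝ (Fin d)} {run : Ω → ℕ → DNSSState m d} {ε : ℝ}
    (H : IsDNSSRun f σ L D g P ξ W (1 / (2 * L)) B R x₀ run) (hB : ∀ i, B i ≠ 0) (hm : 2 ≤ m)
    (hL : 0 < L) (hsmooth : SmoothWith L (avgObjective f))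
    (hbdd : BddBelow (Set.range (avgObjective f)))
    (hW : IsCommunicationMatrix G W) (hε : 0 < ε)
    (hv : ∑ i, σ i ^ 2 / B i ≤ (m : ℝ) ^ 2 * (ε ^ 2 / 16))
    (hR : R = mixRounds 20 m (spectralGap W) (initialGradSize f x₀) ε) {n : ℕ}
    (hn : 8 * (4 * L * initialGap (avgObjective f) x₀) ≤ n * ε ^ 2) (i : Fin m) :
    ∑ t ∈ Finset.range n, ∫ ω, ‖gradient (avgObjective f) ((run ω t).x i)‖ ^ 2 ∂P ≤
      n * ε ^ 2 := by
  have hm0 : m ≠ 0 := by omega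
  have hM : (2 : ℝ) ≤ m := by exact_mod_cast hm
  have hv0 : ((m : ℝ) ^ 2)⁻¹ * ∑ i, σ i ^ 2 / B i ≤ ε ^ 2 / 16 := by
    rw [inv_mul_le_iff₀ (by positivity)]; exact hv
  have hs1 := H.integral_devSq_s_one_le_of_mixRounds hB hm hW hε hv hR
  have hRβ : ∀ t, (3 * Real.exp (-(R t * √(spectralGap W) / 2))) ^ 2 ≤ 9 * ((m : ℝ) ^ 20)⁻¹ :=
    fun t => by
      rw [hR]
      exact sq_contraction_mixRounds_le hm (hW.spectralGap_mem hm).1 (Real.sqrt_nonneg _) hε t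
  have hβ0 : 0 ≤ 9 * ((m : ℝ) ^ 20)⁻¹ := by positivity
  -- This holds because `18000 < 2¹⁵ ≤ m¹⁵`.
  have hβM : 2000 * (9 * ((m : ℝ) ^ 20)⁻¹ * (m : ℝ) ^ 5) ≤ 1 := by
    have h15 : (2 : ℝ) ^ 15 ≤ (m : ℝ) ^ 15 := by gcongr
    have e1 : 2000 * (9 * ((m : ℝ) ^ 20)⁻¹ * (m : ℝ) ^ 5) = 18000 / (m : ℝ) ^ 15 := by
      field_simp; norm_num
    rw [e1, div_le_one (by positivity)]
    linarith
  generalize 9 * ((m : ℝ) ^ 20)⁻¹ = β at hs1 hRβ hβ0 hβM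
  have hX0 : ∀ t, 0 ≤ ∫ ω, devSq (run ω t).x ∂P := fun t =>
    integral_nonneg fun ω => devSq_nonneg _
  -- Weighting the iterate error by `L²` makes the recursion free of `L`, as `L²η² = 1/4`.
  have hstep1 : ∀ t, L ^ 2 * ∫ ω, devSq (run ω (t + 1)).x ∂P ≤
      2 * β * (L ^ 2 * ∫ ω, devSq (run ω t).x ∂P + (∫ ω, devSq (run ω (t + 1)).s ∂P) / 4) := by
    intro t
    have h := mul_le_mul_of_nonneg_left (H.integral_devSq_x_succ_le hB hm hW (hRβ t))
      (sq_nonneg L)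
    refine h.trans (le_of_eq ?_)
    generalize ∫ ω, devSq (run ω t).x ∂P = a
    generalize ∫ ω, devSq (run ω (t + 1)).s ∂P = b
    field_simp; ring
  have hstep2 : ∀ t, ∫ ω, devSq (run ω (t + 2)).s ∂P ≤
      2 * β * (∫ ω, devSq (run ω (t + 1)).s ∂P + (8 * ((m : ℝ) ^ 2 * (ε ^ 2 / 16)) +
        2 * (m : ℝ) ^ 2 * (2 * (L ^ 2 * ∫ ω, devSq (run ω (t + 1)).x ∂P) +
          2 * (L ^ 2 * ∫ ω, devSq (run ω t).x ∂P) + m / 4 *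
          (3 * ∫ ω, ‖gradient (avgObjective f) (nodeAvg (run ω t).x)‖ ^ 2 ∂P +
            3 * (m * (L ^ 2 * ∫ ω, devSq (run ω t).x ∂P)) + 3 * (ε ^ 2 / 16))))) := by
    intro t
    refine (H.integral_devSq_s_add_two_le hsmooth hB hm hW (hRβ (t + 1))).trans ?_
    generalize ∫ ω, devSq (run ω (t + 1)).s ∂P = b
    generalize ∫ ω, devSq (run ω t).x ∂P = a
    generalize ∫ ω, devSq (run ω (t + 1)).x ∂P = a'
    generalize ∫ ω, ‖gradient (avgObjective f) (nodeAvg (run ω t).x)‖ ^ 2 ∂P = F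
    have e1 : 2 * ((m : ℝ) * L) ^ 2 * (m * (1 / (2 * L)) ^ 2) = 2 * (m : ℝ) ^ 2 * (m / 4) := by
      field_simp; norm_num
    gcongr 2 * β * (_ + ?_)
    refine add_le_add (mul_le_mul_of_nonneg_left hv (by norm_num)) ?_
    calc _ = 2 * ((m : ℝ) * L) ^ 2 * (2 * a' + 2 * a) +
          2 * ((m : ℝ) * L) ^ 2 * (m * (1 / (2 * L)) ^ 2) * (3 * F + 3 * (m * L ^ 2 * a) +
            3 * (((m : ℝ) ^ 2)⁻¹ * ∑ i, σ i ^ 2 / B i)) := by ring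
      _ ≤ 2 * ((m : ℝ) * L) ^ 2 * (2 * a' + 2 * a) +
          2 * (m : ℝ) ^ 2 * (m / 4) * (3 * F + 3 * (m * L ^ 2 * a) + 3 * (ε ^ 2 / 16)) := by
        rw [e1]; gcongr
      _ = _ := by ring
  have hdesc : ∑ t ∈ Finset.range n,
      ∫ ω, ‖gradient (avgObjective f) (nodeAvg (run ω t).x)‖ ^ 2 ∂P ≤
      4 * L * initialGap (avgObjective f) x₀ + ∑ t ∈ Finset.range n,
        (m * (L ^ 2 * ∫ ω, devSq (run ω t).x ∂P) + ε ^ 2 / 32) := by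
    refine (H.sum_integral_sq_norm_gradient_le hm0 hL hsmooth hbdd hB hW n).trans ?_
    refine add_le_add le_rfl (Finset.sum_le_sum fun t _ => ?_)
    rw [mul_assoc (m : ℝ)]
    linarith
  refine (Finset.sum_le_sum fun t _ =>
    H.integral_sq_norm_gradient_node_le hsmooth hB t i).trans ?_
  exact sum_stationarity_le (p := fun t => L ^ 2 * ∫ ω, devSq (run ω t).x ∂P)
    (s := fun t => ∫ ω, devSq (run ω t).s ∂P) hM hβ0 hβM (sq_nonneg ε)
    (fun t => mul_nonneg (sq_nonneg L) (hX0 t))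
    (fun t => integral_nonneg fun ω => devSq_nonneg _)
    (fun t => integral_nonneg fun ω => by positivity)
    (by simp [H.run_zero, devSq_const hm0]) hs1 hstep1 hstep2 hdesc hn

theorem commRounds_le {m : ℕ} (hm : 2 ≤ m) {χ G₀ ε K : ℝ} (hχ : 0 < χ) (hχ1 : χ ≤ 1)
    (hG : 0 ≤ G₀) (hε : 0 < ε) {T : ℕ} (hT : (T : ℝ) ≤ 34 * (K / ε ^ 2)) :
    ∑ s ∈ Finset.range T, 2 * (mixRounds 20 m χ G₀ ε s : ℝ) ≤
      1500 * (K / (√χ * ε ^ 2)) * Real.log (m * (1 + G₀ / ε)) := by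
  have hM : (2 : ℝ) ≤ m := by exact_mod_cast hm
  have hK : 0 ≤ K / ε ^ 2 := by linarith [(Nat.cast_nonneg T : (0 : ℝ) ≤ T)]
  have hs : 0 < √χ := Real.sqrt_pos.2 hχ
  have hr : ∀ s ∈ Finset.range T, 2 * (mixRounds 20 m χ G₀ ε s : ℝ) ≤
      2 * ((20 + 2) / √χ * Real.log (m * (1 + G₀ / ε))) := fun s _ => by
    linarith [mixRounds_le hm (by norm_num : (0 : ℝ) ≤ 20) hχ hχ1 hG hε s]
  have hlog : 0 ≤ Real.log (m * (1 + G₀ / ε)) := by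
    apply Real.log_nonneg
    nlinarith [div_nonneg hG hε.le]
  refine (Finset.sum_le_sum hr).trans ?_
  generalize Real.log (m * (1 + G₀ / ε)) = l at hlog
  rw [Finset.sum_const, Finset.card_range, nsmul_eq_mul]
  calc (T : ℝ) * (2 * ((20 + 2) / √χ * l))
      ≤ 34 * (K / ε ^ 2) * (2 * ((20 + 2) / √χ * l)) := by gcongr
    _ = 1496 * (K / ε ^ 2 * (l / √χ)) := by ring
    _ ≤ 1500 * (K / ε ^ 2 * (l / √χ)) := by gcongr; norm_num
    _ = _ := by field_simp

theorem gradEvals_le {m : ℕ} {σ : Fin m → ℝ} (hσ : ∀ i, 0 < σ i) {ε K : ℝ} {T : ℕ}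
    (hT : (T : ℝ) ≤ 34 * (K / ε ^ 2)) :
    T * ∑ i, (batchSize σ ε i : ℝ) ≤
      1500 * (K * sigmaAM σ ^ 2 / ε ^ 4 + m * K / ε ^ 2) := by
  have hK : 0 ≤ K / ε ^ 2 := by linarith [(Nat.cast_nonneg T : (0 : ℝ) ≤ T)]
  have h1 : 0 ≤ K / ε ^ 2 * (sigmaAM σ ^ 2 / ε ^ 2) := by positivity
  have h2 : 0 ≤ K / ε ^ 2 * m := by positivity
  have h3 : K * sigmaAM σ ^ 2 / ε ^ 4 + m * K / ε ^ 2 =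
      K / ε ^ 2 * (sigmaAM σ ^ 2 / ε ^ 2) + K / ε ^ 2 * m := by ring
  calc (T : ℝ) * ∑ i, (batchSize σ ε i : ℝ)
      ≤ 34 * (K / ε ^ 2) * (16 * sigmaAM σ ^ 2 / ε ^ 2 + m) := by
        gcongr; exact sum_batchSize_le hσ
    _ = 544 * (K / ε ^ 2 * (sigmaAM σ ^ 2 / ε ^ 2)) + 34 * (K / ε ^ 2 * m) := by ring
    _ ≤ _ := by rw [h3]; linarith

theorem theorem2p1 :
    ∃ c C : ℝ, 0 < c ∧ 0 < C ∧
      ∀ (m d : ℕ) (_hm : 2 ≤ m)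
        -- the problem: local objectives, starting point, network
        (f : Fin m → EuclideanSpace ℝ (Fin d) → ℝ) (x₀ : EuclideanSpace ℝ (Fin d))
        (L : ℝ) (_hL : 0 < L)
        (_hbdd : BddBelow (Set.range (avgObjective f)))
        (_hsmooth : SmoothWith L (avgObjective f))
        (_hsmooth_loc : ∀ i, SmoothWith ((m : ℝ) * L) (f i))
        (G : SimpleGraph (Fin m)) (W : Matrix (Fin m) (Fin m) ℝ)
        (_hW : IsCommunicationMatrix G W)
        -- the stochastic gradients
        (Ξ : Fin m → Type*) [∀ i, MeasurableSpace (Ξ i)]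
        (D : ∀ i, Measure (Ξ i)) [∀ i, IsProbabilityMeasure (D i)]
        (g : ∀ i, EuclideanSpace ℝ (Fin d) → Ξ i → EuclideanSpace ℝ (Fin d))
        (σ : Fin m → ℝ) (_hσ : ∀ i, 0 < σ i)
        (_hg : ∀ i, IsStochasticGradient (D i) (g i) (f i) (σ i))
        (ε : ℝ) (_hε : 0 < ε)
        -- the parameters of the algorithm
        (Δ : ℝ) (_hΔ : Δ = initialGap (avgObjective f) x₀)
        (T : ℕ) (_hT : T = numIter Δ L ε)
        (η : ℝ) (_hη : η = 1 / (2 * L))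
        (B : Fin m → ℕ) (_hB : B = batchSize σ ε)
        (R : ℕ → ℕ) (_hR : R = mixRounds c m (spectralGap W) (initialGradSize f x₀) ε)
        -- the randomness: independent samples `ξ t i j ∼ D i` and an independent uniform index
        (Ω : Type*) [MeasurableSpace Ω] (P : Measure Ω) [IsProbabilityMeasure P]
        (ξ : ℕ → ∀ i : Fin m, ℕ → Ω → Ξ i)
        (_hξ_meas : ∀ t i j, Measurable (ξ t i j))
        (_hξ_law : ∀ t i j, P.map (ξ t i j) = D i)
        (_hξ_indep : iIndepFun (fun p : ℕ × Fin m × ℕ => ξ p.1 p.2.1 p.2.2) P)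
        (τ : Ω → Fin (T + 1)) (_hτ_meas : Measurable τ)
        (_hτ_law : P.map τ = (PMF.uniformOfFintype (Fin (T + 1))).toMeasure)
        (_hτ_indep : IndepFun τ (fun ω (p : ℕ × Fin m × ℕ) => ξ p.1 p.2.1 p.2.2 ω) P)
        -- the run of the algorithm
        (run : Ω → ℕ → DNSSState m d)
        (_hrun : run = fun ω => dnss g W η B R x₀ (fun t i j => ξ t i j ω)),
        -- the output of every node is an `ε`-stationary point in expectation
        (∀ i : Fin m,
          Integrable (fun ω => ‖gradient (avgObjective f) ((run ω (τ ω)).x i)‖ ^ 2) P ∧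
          ∫ ω, ‖gradient (avgObjective f) ((run ω (τ ω)).x i)‖ ^ 2 ∂P ≤ ε ^ 2) ∧
        -- sample and communication complexity
        (ε ^ 2 ≤ 2 * Δ * L → ∀ ω,
          ((run ω T).gradEvals : ℝ) ≤
              C * (Δ * L * sigmaAM σ ^ 2 / ε ^ 4 + m * Δ * L / ε ^ 2) ∧
          ((run ω T).commRounds : ℝ) ≤
              C * (Δ * L / (√(spectralGap W) * ε ^ 2)) *
                Real.log (m * (1 + initialGradSize f x₀ / ε))) := by
  -- Here `1500` rounds up `34 · 2 · 22 = 1496`: iterations, two mixing calls, and `c + 2` for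
  -- rounding. The gradient count needs only `34 · 16 = 544`.
  refine ⟨20, 1500, by norm_num, by norm_num, ?_⟩
  intro m d hm f x₀ L hL hbdd hsmooth hloc G W hW Ξ _ D _ g σ hσ hg ε hε Δ hΔ T hT η hη B hB R hR
    Ω _ P _ ξ hξm hξl hξi τ hτm hτl hτi run hrun
  constructor
  · intro i
    rw [hη] at hrun
    have H : IsDNSSRun f σ L D g P ξ W (1 / (2 * L)) B R x₀ run := ⟨hloc, hg, hξm, hξl, hξi, hrun⟩
    have hB0 : ∀ i, B i ≠ 0 := fun i => by rw [hB]; exact batchSize_ne_zero hσ hε i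
    have hv : ∑ i, σ i ^ 2 / B i ≤ (m : ℝ) ^ 2 * (ε ^ 2 / 16) := by
      rw [hB]; exact sum_sq_div_batchSize_le (by omega) hσ hε
    -- The output is drawn from `T + 1` iterates, and `T ≥ 32ΔL/ε²` keeps the descent budget `4LΔ`
    -- within an eighth of `(T + 1)ε²`.
    have hn : 8 * (4 * L * initialGap (avgObjective f) x₀) ≤ (T + 1 : ℕ) * ε ^ 2 := by
      have h1 : 32 * Δ * L / ε ^ 2 ≤ T := by rw [hT]; exact Nat.le_ceil _
      rw [div_le_iff₀ (by positivity)] at h1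
      rw [← hΔ]
      push_cast
      linarith [sq_nonneg ε]
    have hind := fun t => (H.indepFun_of_indepFun_samples hτi t i).comp measurable_id
      (hsmooth.measurable_gradient.norm.pow_const 2)
    have hint := fun t => integrable_sq_norm (hsmooth.memLp_gradient ((H.memLp_run hB0 t).1 i))
    obtain ⟨h1, h2⟩ := integral_uniform_index
      (φ := fun t ω => ‖gradient (avgObjective f) ((run ω t).x i)‖ ^ 2) hτm hτl hint hind
    refine ⟨h1, ?_⟩
    rw [h2, inv_mul_le_iff₀ (by positivity)]
    exact H.sum_integral_le hB0 hm hL hsmooth hbdd hW hε hv hR hn i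
  · intro hΔε ω
    have hcount := dnss_counts g W η B R x₀ (fun t i j => ξ t i j ω) T
    have hTle : (T : ℝ) ≤ 34 * (Δ * L / ε ^ 2) := by rw [hT]; exact numIter_le hε hΔε
    obtain ⟨hχ, hχ1⟩ := hW.spectralGap_mem hm
    rw [hrun]
    simp only [hcount.1, hcount.2]
    push_cast
    rw [mul_assoc (m : ℝ) Δ L, hB, hR]
    exact ⟨gradEvals_le hσ hTle, commRounds_le hm hχ hχ1 (Real.sqrt_nonneg _) hε hTle⟩
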